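/- Let $S^1=\mathbb R/\mathbb Z$. A $P$-homeomorphism is an orientation-preserving circle homeomorphism $f$ that is differentiable except at a finite set $B(f)$ of break points, where the one-sided derivatives exist and differ, such that $c_1<Df_\pm<c_2$ everywhere for some constants $0<c_1<c_2$ and $v_f:=\operatorname{var}_{S^1}\log Df<\infty$. Put $\sigma_f(b)=Df(b-0)/Df(b+0)$ and $\sigma_f(B)=\prod_{b\in B}\sigma_f(b)$, with $\sigma_f(\emptyset)=1$. Let $f_1,f_2$ be $P$-homeomorphisms with the same irrational rotation number $\rho$. Assume that for some $\alpha>0$ each $f_i$ is $C^{2+\alpha}$ on each interval of continuity of $Df_i$ (uniformly up to the end points), and that $\sigma_{f_1}(B(f_1))\ne\sigma_{f_2}(B(f_2))$. Let $p_n/q_n$ be the convergents of $\rho$ and $v_i=v_{f_i}$. Call $B_1\subset B(f_1)$, $B_2\subset B(f_2)$ *not coinciding* if $\sigma_{f_1}(B_1)\neq\sigma_{f_2}(B_2)$. *Regular coverings.* Let $f$ be one of $f_1,f_2$, $B\subset B(f)$, $x\in S^1$, $r\in\mathbb N$, and $z_1\prec z_2\prec z_3\prec z_4\prec z_1$ in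 $S^1$. The triple $([z_1,z_2],[z_2,z_3],[z_3,z_4])$ covers $B$ $(K,M,\delta,\zeta;x)$-regularly with $r$ if the arcs $f^j([z_1,z_4])$, $0\le j<r$, are pairwise disjoint except for end points, and 1. $[z_1,z_4]\subset(x-\delta,x+\delta)$, and every $b\in B$ lies in exactly one of these arcs; 2. for every $b\in B$, its preimage $\bar b=f^{-l}(b)\in[z_1,z_4]$, $0\le l<r$, lies in $[z_1,z_2]$; 3. $M\ell([z_1,z_2])\le\ell([z_2,z_3])\le K\ell([z_1,z_2])$ and $K^{-1}\ell([z_3,z_4])\le\ell([z_2,z_3])\le K\ell([z_3,z_4])$; 4. the lengths of $f^r([z_s,z_{s+1}])$, $s=1,2,3$, are pairwise $K$-comparable, i.e. have ratios in $[K^{-1},K]$; 5. the circle distances of $z_i$ and of $f^r(z_i)$ to $x$, $1\le i\le4$, are at most $K\ell([z_1,z_2])$; 6. $\ell([\bar b,z_2])/\ell([z_1,z_2])<\zeta$ for every $b\in B$. Let $h$ be a conjugacy, $h\circ f_1=f_2\circ h$, preserving orientation. The triples of $z=(z_1,\dots,z_4)$ and $h(z)=(h(z_1),\dots,h(z_4))$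 cover $B_1$ and $B_2$ $(K,M,\delta,\zeta;x_0,h(x_0))$-regularly with $r$ if $B_1$ (resp. $B_2$) is exactly the set of break points of $f_1$ (resp. $f_2$) lying in $\bigcup_{0\le j<r}f_1^j([z_1,z_4])$ (resp. $\bigcup_{0\le j<r}f_2^j(h([z_1,z_4]))$); and, if $B_1\ne\emptyset$, the triple of $z$ covers $B_1$ $(K,M,\delta,\zeta;x_0)$-regularly with $r$ for $f_1$; and, if $B_2\neq\emptyset$, the triple of $h(z)$ covers $B_2$ $(K,M,\delta,\zeta;h(x_0))$-regularly with $r$ for $f_2$. *Distortion.* For $z_1<z_2<z_3<z_4$ let $Cr(z_1,z_2,z_3,z_4)=\frac{(z_2-z_1)(z_4-z_3)}{(z_3-z_1)(z_4-z_2)}$. For $z_1\prec z_2\prec z_3\prec z_4\prec z_1$ in $S^1$ let $Dist(z_1,\dots,z_4;f)=Cr(F(\hat z_1),\dots,F(\hat z_4))/Cr(\hat z_1,\dots,\hat z_4)$, where $F$ is a lift of $f$ and $\hat z_1<\hat z_2<\hat z_3<\hat z_4<\hat z_1+1$ are lifts of the $z_i$. **Lemma.** There are constants $\Omega>1$, $\vartheta\in(0,1)$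 and $R_5>0$, depending only on $f_1$ and $f_2$, with the following two properties. (i) Put $G_\sigma(x,y)=\frac{[\sigma+(1-\sigma)y](1+x)}{\sigma+(1-\sigma)y+x}$. For all not coinciding $B_1\subset B(f_1)$, $B_2\subset B(f_2)$, for $i=1,2$, and for all $x_b\ge\Omega$, $y_b\in[0,\vartheta)$ ($b\in B_i$), $$\Big|\prod_{b\in B_i}G_{\sigma_{f_i}(b)}(x_b,y_b)-\sigma_{f_i}(B_i)\Big|\le\tfrac18\min\{\sigma_{f_1}(B_1),\sigma_{f_2}(B_2),|\sigma_{f_1}(B_1)-\sigma_{f_2}(B_2)|\}.$$ (ii) Put $M_0=\Omega e^{\max\{v_1,v_2\}}$ and $\zeta_0=\vartheta e^{-\min\{v_1,v_2\}}$. For every orientation-preserving conjugacy $h$ with $h\circ f_1=f_2\circ h$, every $x_0\in S^1$ (in particular every $x_0$ with $Dh(x_0)>0$), every $K_0>M_0$ and every $\delta>0$ there is $N$ such that for all $n\ge N$ and all $r_n\in\{q_{n-1},q_n,q_n+q_{n-1}\}$: if the triples of $z$ and $h(z)$ cover not coinciding sets $B_1\subset B(f_1)$ and $B_2\subset B(f_2)$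 $(K_0,M_0,\delta,\zeta_0;x_0,h(x_0))$-regularly with $r_n$, then $$\left|\frac{Dist(z_1,z_2,z_3,z_4;f_1^{r_n})}{Dist(h(z_1),h(z_2),h(z_3),h(z_4);f_2^{r_n})}-1\right|\ge R_5 .$$ -/

import Mathlib

open Set

namespace BreakCircle

/-- `F` is a lift of the circle homeomorphism `f` of `S¹ = ℝ/ℤ`. Elements of `CircleDeg1Lift` are
monotone maps with `F (x + 1) = F x + 1`; having such a lift says that `f` preserves orientation, and
the lift of a homeomorphism is automatically continuous and strictly increasing. -/
def IsLift (F : CircleDeg1Lift) (f : UnitAddCircle ≃ₜ UnitAddCircle) : Prop :=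
  ∀ x : ℝ, f (x : UnitAddCircle) = ((F x : ℝ) : UnitAddCircle)

/-- `D F(x - 0)`. -/
noncomputable def leftDeriv (F : CircleDeg1Lift) (x : ℝ) : ℝ := derivWithin F (Iic x) x

/-- `D F(x + 0)`. -/
noncomputable def rightDeriv (F : CircleDeg1Lift) (x : ℝ) : ℝ := derivWithin F (Ici x) x

/-- The set `B(f) ⊆ S¹` of break points: the points where `f` is not differentiable. -/
def breakSet (F : CircleDeg1Lift) : Set UnitAddCircle :=
  {b | ∃ x : ℝ, (x : UnitAddCircle) = b ∧ ¬ DifferentiableAt ℝ F x}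

/-- The total variation of `log Df` over the circle. The right derivative gives the value of `Df` at
the finitely many break points; one full period `[0, 1]` runs once around the circle. -/
noncomputable def logVar (F : CircleDeg1Lift) : ENNReal :=
  eVariationOn (fun x : ℝ => Real.log (rightDeriv F x)) (Icc 0 1)

/-- Class `P`: differentiable off a finite set of break points, with one-sided derivatives there, all
(one-sided) derivatives between two positive constants, and `log Df` of bounded variation.
(Where both one-sided derivatives exist, being a break point means that they differ.) -/
structure IsPHomeo (F : CircleDeg1Lift) : Prop where
  finite_breaks : (breakSet F).Finite
  left_diff : ∀ x : ℝ, DifferentiableWithinAt ℝ F (Iic x) x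
  right_diff : ∀ x : ℝ, DifferentiableWithinAt ℝ F (Ici x) x
  bounds : ∃ c₁ c₂ : ℝ, 0 < c₁ ∧ c₁ < c₂ ∧ ∀ x : ℝ,
    (c₁ < leftDeriv F x ∧ leftDeriv F x < c₂) ∧ (c₁ < rightDeriv F x ∧ rightDeriv F x < c₂)
  bounded_variation : logVar F ≠ ⊤

/-- `f` is `C^{2+α}` for some `α > 0` on each interval of continuity of `Df`, i.e. on each interval
without break points: `f` is `C²` there and `D²f` is `α`-Hölder (uniformly up to the end points).
The restriction `α ≤ 1` is no loss, since `C^{2+α}` with `α > 1` is contained in `C^{2+1}`. -/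
def IsPiecewiseC2Holder (F : CircleDeg1Lift) : Prop :=
  ∃ α C : ℝ, 0 < α ∧ α ≤ 1 ∧
    ContDiffOn ℝ 2 F {x : ℝ | (x : UnitAddCircle) ∉ breakSet F} ∧
    ∀ x y : ℝ, x < y → (∀ t ∈ Icc x y, (t : UnitAddCircle) ∉ breakSet F) →
      |deriv (deriv F) x - deriv (deriv F) y| ≤ C * (y - x) ^ α

/-- The jump ratio `σ_f(b) = Df(b - 0) / Df(b + 0)` at a point of the circle (computed at the
representative of `b` in `[0, 1)`). -/
noncomputable def jump (F : CircleDeg1Lift) (b : UnitAddCircle) : ℝ :=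
  leftDeriv F (AddCircle.equivIco (1 : ℝ) 0 b : ℝ) / rightDeriv F (AddCircle.equivIco (1 : ℝ) 0 b : ℝ)

/-- The product of the jump ratios over a (finite) set of points; it is `1` for the empty set. -/
noncomputable def jumpProd (F : CircleDeg1Lift) (B : Set UnitAddCircle) : ℝ :=
  ∏ᶠ b ∈ B, jump F b

/-- The denominator `q_n` of the `n`-th convergent `p_n / q_n = [k₁, …, k_n]` (in lowest terms) of
the rotation number; the integer part of the translation number does not change it. -/
noncomputable def qden (F : CircleDeg1Lift) (n : ℕ) : ℕ :=
  (Real.convergent F.translationNumber n).den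

/-- The cross-ratio of four real numbers. -/
noncomputable def crossRatio (z : Fin 4 → ℝ) : ℝ :=
  ((z 1 - z 0) * (z 3 - z 2)) / ((z 2 - z 0) * (z 3 - z 1))

/-- The distortion of the cross-ratio of `z` under `G : ℝ → ℝ`. -/
noncomputable def distortion (z : Fin 4 → ℝ) (G : ℝ → ℝ) : ℝ :=
  crossRatio (fun i => G (z i)) / crossRatio z

/-- `z` is the lift of four circle points with `z₁ ≺ z₂ ≺ z₃ ≺ z₄ ≺ z₁`. -/
def CyclicLift (z : Fin 4 → ℝ) : Prop :=
  z 0 < z 1 ∧ z 1 < z 2 ∧ z 2 < z 3 ∧ z 3 < z 0 + 1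

/-- The closed arc `f^j([z₁, z₄])` of the circle. -/
def iterArc (F : CircleDeg1Lift) (z : Fin 4 → ℝ) (j : ℕ) : Set UnitAddCircle :=
  (fun t : ℝ => (t : UnitAddCircle)) '' Icc (F^[j] (z 0)) (F^[j] (z 3))

/-- `[z₁, z₄]` is `r`-small: its images `f^j([z₁, z₄])`, `0 ≤ j < r`, are pairwise disjoint except
for end points. -/
def IsSmall (F : CircleDeg1Lift) (r : ℕ) (z : Fin 4 → ℝ) : Prop :=
  ∀ i < r, ∀ j < r, i ≠ j →
    Disjoint ((fun t : ℝ => (t : UnitAddCircle)) '' Ioo (F^[i] (z 0)) (F^[i] (z 3)))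
      ((fun t : ℝ => (t : UnitAddCircle)) '' Ioo (F^[j] (z 0)) (F^[j] (z 3)))

/-- The break points lying in the union of the arcs `f^j([z₁, z₄])`, `0 ≤ j < r`. -/
def coveredBreaks (F : CircleDeg1Lift) (r : ℕ) (z : Fin 4 → ℝ) : Set UnitAddCircle :=
  {b | b ∈ breakSet F ∧ ∃ j < r, b ∈ iterArc F z j}

/-- `K`-comparability of two lengths. -/
def Comparable (K a b : ℝ) : Prop := K⁻¹ * b ≤ a ∧ a ≤ K * b

/-- The distance on the circle of the points with lifts `x` and `y`. -/
noncomputable def cdist (x y : ℝ) : ℝ := ‖((x - y : ℝ) : UnitAddCircle)‖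

/-- The triple `([z₁,z₂], [z₂,z₃], [z₃,z₄])` covers the set `B` of break points of `f`
`(K, M, δ, ζ; x₀)`-regularly with the iterate `r`. -/
structure RegularCover (F : CircleDeg1Lift) (B : Set UnitAddCircle) (K M δ ζ x₀ : ℝ) (r : ℕ)
    (z : Fin 4 → ℝ) : Prop where
  cyclic : CyclicLift z
  small : IsSmall F r z
  near : ∀ t ∈ Icc (z 0) (z 3), cdist t x₀ < δ
  once : ∀ b ∈ B, ∃! j : ℕ, j < r ∧ b ∈ iterArc F z j
  /-- every `r`-preimage `t ∈ [z₁, z₄]` of a point of `B` lies in `[z₁, z₂]` -/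
  preimage_mem : ∀ b ∈ B, ∀ l < r, ∀ t ∈ Icc (z 0) (z 3),
    ((F^[l] t : ℝ) : UnitAddCircle) = b → t ∈ Icc (z 0) (z 1)
  lower : M * (z 1 - z 0) ≤ z 2 - z 1
  upper : z 2 - z 1 ≤ K * (z 1 - z 0)
  comparable_last : Comparable K (z 2 - z 1) (z 3 - z 2)
  comparable_image₁₂ : Comparable K (F^[r] (z 1) - F^[r] (z 0)) (F^[r] (z 2) - F^[r] (z 1))
  comparable_image₂₃ : Comparable K (F^[r] (z 2) - F^[r] (z 1)) (F^[r] (z 3) - F^[r] (z 2))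
  comparable_image₁₃ : Comparable K (F^[r] (z 1) - F^[r] (z 0)) (F^[r] (z 3) - F^[r] (z 2))
  dist_le : ∀ i, cdist (z i) x₀ ≤ K * (z 1 - z 0) ∧ cdist (F^[r] (z i)) x₀ ≤ K * (z 1 - z 0)
  /-- the normalised distance of every `r`-preimage from `z₂` is less than `ζ` -/
  preimage_close : ∀ b ∈ B, ∀ l < r, ∀ t ∈ Icc (z 0) (z 3),
    ((F^[l] t : ℝ) : UnitAddCircle) = b → (z 1 - t) / (z 1 - z 0) < ζ

/-- The triples of `z` and of `h(z)` cover `B₁` and `B₂`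
`(K, M, δ, ζ; x₀, h(x₀))`-regularly with the iterate `r`: the break points of `f₁`, `f₂` covered by
the iterates of the triples are exactly those in `B₁`, `B₂`, and the covering of each nonempty `B_i`
is regular. -/
structure RegularPairCover (F₁ F₂ H : CircleDeg1Lift) (B₁ B₂ : Set UnitAddCircle)
    (K M δ ζ x₀ : ℝ) (r : ℕ) (z : Fin 4 → ℝ) : Prop where
  covered₁ : coveredBreaks F₁ r z = B₁
  covered₂ : coveredBreaks F₂ r (fun i => H (z i)) = B₂
  regular₁ : B₁.Nonempty → RegularCover F₁ B₁ K M δ ζ x₀ r z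
  regular₂ : B₂.Nonempty → RegularCover F₂ B₂ K M δ ζ (H x₀) r (fun i => H (z i))

/-- The sets `B₁`, `B₂` of break points are not (jump-)coinciding. -/
def NotCoinciding (F₁ F₂ : CircleDeg1Lift) (B₁ B₂ : Set UnitAddCircle) : Prop :=
  jumpProd F₁ B₁ ≠ jumpProd F₂ B₂

/-- The function `G(x, y)` belonging to a break point with jump ratio `s`. -/
noncomputable def jumpFun (s x y : ℝ) : ℝ :=
  ((s + (1 - s) * y) * (1 + x)) / (s + (1 - s) * y + x)

/-- `Λ = min {σ₁(B₁), σ₂(B₂), |σ₁(B₁) - σ₂(B₂)|}`. -/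
noncomputable def jumpGap (F₁ F₂ : CircleDeg1Lift) (B₁ B₂ : Set UnitAddCircle) : ℝ :=
  min (min (jumpProd F₁ B₁) (jumpProd F₂ B₂)) |jumpProd F₁ B₁ - jumpProd F₂ B₂|

/-- `Ω` and `ϑ` are such that, for all not coinciding sets of break points, the products of the
functions `G` at arguments `x ≥ Ω`, `y ∈ [0, ϑ)` are within `Λ / 8` of the products of the jumps. -/
def JumpConstants (F₁ F₂ : CircleDeg1Lift) (Ω ϑ : ℝ) : Prop :=
  1 < Ω ∧ 0 < ϑ ∧ ϑ < 1 ∧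
  ∀ B₁ ⊆ breakSet F₁, ∀ B₂ ⊆ breakSet F₂, NotCoinciding F₁ F₂ B₁ B₂ →
    (∀ x y : UnitAddCircle → ℝ, (∀ b ∈ B₁, Ω ≤ x b ∧ 0 ≤ y b ∧ y b < ϑ) →
      |(∏ᶠ b ∈ B₁, jumpFun (jump F₁ b) (x b) (y b)) - jumpProd F₁ B₁| ≤ jumpGap F₁ F₂ B₁ B₂ / 8) ∧
    (∀ x y : UnitAddCircle → ℝ, (∀ b ∈ B₂, Ω ≤ x b ∧ 0 ≤ y b ∧ y b < ϑ) →
      |(∏ᶠ b ∈ B₂, jumpFun (jump F₂ b) (x b) (y b)) - jumpProd F₂ B₂| ≤ jumpGap F₁ F₂ B₁ B₂ / 8)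

/-- `M₀ = Ω e^{max(v₁, v₂)}`. -/
noncomputable def constM (F₁ F₂ : CircleDeg1Lift) (Ω : ℝ) : ℝ :=
  Ω * Real.exp (max (logVar F₁).toReal (logVar F₂).toReal)

/-- `ζ₀ = ϑ e^{-min(v₁, v₂)}`. -/
noncomputable def constζ (F₁ F₂ : CircleDeg1Lift) (ϑ : ℝ) : ℝ :=
  ϑ * Real.exp (-min (logVar F₁).toReal (logVar F₂).toReal)

end BreakCircle

namespace BreakCircle

open Filter Topology

/-! ### Disjoint arcs on the circle, variation, and lifts. -/

section

/-! The distortion of a cross-ratio is multiplicative along orbits, so `log Dist(z; f^r)` is the sum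
of the one-step logarithms over the `r` arcs `f^j([z₁, z₄])` (`log_distortion_iterate`).

On an arc of length `L` without break points, slopes of chords are affine in the midpoint up to
`O(L^{1+α})`. The first-order terms cancel in the cross-ratio, so the logarithm is `O(L^{1+α})`
(`SmoothBounds.abs_log_distortion_le`). Disjoint arcs have total length at most `1`, so together
they contribute `O(max L^α)`. On a short arc whose first part contains the break point `b`, `f` is
nearly a broken line with two slopes, for which the distortion is exactly `G_{σ(b)}(x_b, y_b)`; the
error is `O(L)` (`SmoothBounds.abs_log_distortion_sub_log_jumpFun_le`), and there are finitely many
such arcs. Hence `Dist(z; f^r)` is close to `∏ G_{σ(b)}(x_b, y_b)` as soon as all arcs are short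
(`IsPHomeo.exists_log_distortion_close`).

The arcs are uniformly short for large `r` by Denjoy's theorem: the semiconjugacy `Φ` to the
rotation is strictly increasing, and `r` disjoint arcs of equal `Φ`-length have `Φ`-length at most
`1/r` (`IsPHomeo.exists_iterate_sub_lt`). The denominators `q_n` tend to infinity, so this applies
to `r_n`.

Here `x_b`, `y_b` are ratios of lengths at the time when the arc meets `b`. By bounded distortion
they differ from the ratios at time `0` by a factor at most `e^v`, so the choice of `M₀` and `ζ₀`
gives `x_b ≥ Ω` and small `y_b`. Since `G_σ(x, y) → σ` as `x → ∞`, `y → 0`, the products are close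
to `σ_{f_i}(B_i)`. These differ when the sets do not coincide, and there are only finitely many
pairs of sets, so the quotient of distortions stays uniformly away from `1` (`exists_uniform_gap`).
-/

theorem coe_eq_coe_iff (x y : ℝ) :
    (x : UnitAddCircle) = (y : UnitAddCircle) ↔ ∃ m : ℤ, x = y + m := by
  rw [QuotientAddGroup.eq, AddSubgroup.mem_zmultiples_iff]
  constructor
  · rintro ⟨k, hk⟩
    refine ⟨-k, ?_⟩
    simp at hk
    push_cast
    linarith
  · rintro ⟨m, hm⟩
    refine ⟨-m, ?_⟩
    simp
    linarith

/-- The sum of the increments of a monotone function over non-overlapping intervals. -/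
theorem sum_sub_le_of_Ioo_disjoint {ι : Type*} {W : ℝ → ℝ} (hW : Monotone W) (s : Finset ι)
    (a b : ι → ℝ) (c : ℝ) : ∀ d : ℝ, c ≤ d → (∀ i ∈ s, a i < b i) → (∀ i ∈ s, c ≤ a i) →
    (∀ i ∈ s, b i ≤ d) →
    (∀ i ∈ s, ∀ j ∈ s, i ≠ j → Disjoint (Ioo (a i) (b i)) (Ioo (a j) (b j))) →
    ∑ i ∈ s, (W (b i) - W (a i)) ≤ W d - W c := by
  classical
  induction s using Finset.induction_on_max_value a with
  | empty =>
    intro d hcd _ _ _ _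
    simpa using hW hcd
  | insert i s his hmax ih =>
    intro d hcd hab hc hd hdisj
    rw [Finset.sum_insert his]
    have hlast : ∀ j ∈ s, b j ≤ a i := by
      intro j hj
      have hij : i ≠ j := fun h => his (h ▸ hj)
      have h1 := hdisj i (Finset.mem_insert_self _ _) j (Finset.mem_insert_of_mem hj) hij
      rw [Ioo_disjoint_Ioo, max_eq_left (hmax j hj)] at h1
      rcases min_le_iff.1 h1 with h | h
      · exact absurd (hab i (Finset.mem_insert_self _ _)) (not_lt.2 h)
      · exact h
    have := ih (a i) (hc i (Finset.mem_insert_self _ _))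
      (fun j hj => hab j (Finset.mem_insert_of_mem hj))
      (fun j hj => hc j (Finset.mem_insert_of_mem hj)) hlast
      (fun j hj k hk => hdisj j (Finset.mem_insert_of_mem hj) k (Finset.mem_insert_of_mem hk))
    have h2 := hW (hd i (Finset.mem_insert_self _ _))
    linarith

theorem map_add_int_of_map_add_one {W : ℝ → ℝ} {V : ℝ} (hV : ∀ x, W (x + 1) = W x + V) (x : ℝ)
    (m : ℤ) : W (x + m) = W x + m * V := by
  have h : Function.Periodic (fun x => W x - x * V) 1 := fun x => by
    simp only [hV]; ring
  have := h.int_mul m x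
  simp only [mul_one] at this
  linarith

/-- Arcs of the circle given by lifts `(a i, b i)`: no point of one is a translate of a point of
another. -/
def DisjointArcs (n : ℕ) (a b : ℕ → ℝ) : Prop :=
  ∀ i < n, ∀ j < n, i ≠ j → ∀ x ∈ Ioo (a i) (b i), ∀ y ∈ Ioo (a j) (b j), ∀ m : ℤ, x ≠ y + m

/-- Integer translations bring all arcs into one period starting at `a 0`. It serves for three
functions `W`: the identity (lengths), a variation majorant, and the semiconjugacy to a rotation. -/
theorem sum_sub_le_of_disjointArcs {W : ℝ → ℝ} (hW : Monotone W) {V : ℝ}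
    (hV : ∀ x, W (x + 1) = W x + V) (n : ℕ) (a b : ℕ → ℝ) (hab : ∀ i < n, a i < b i)
    (hone : ∀ i < n, b i ≤ a i + 1) (hdisj : DisjointArcs n a b) :
    ∑ i ∈ Finset.range n, (W (b i) - W (a i)) ≤ V := by
  rcases Nat.eq_zero_or_pos n with rfl | hn
  · have h1 := hV 0
    have h2 := hW (show (0 : ℝ) ≤ 0 + 1 by norm_num)
    simp only [Finset.range_zero, Finset.sum_empty]
    linarith
  set c := a 0 with hc
  set m : ℕ → ℤ := fun i => ⌊a i - c⌋ with hm
  have hm0 : m 0 = 0 := by simp [hm, hc]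
  have hWm : ∀ i, W (b i) - W (a i) = W (b i - m i) - W (a i - m i) := by
    intro i
    have h1 := map_add_int_of_map_add_one hV (b i - m i) (m i)
    have h2 := map_add_int_of_map_add_one hV (a i - m i) (m i)
    simp only [sub_add_cancel] at h1 h2
    linarith
  rw [Finset.sum_congr rfl (fun i _ => hWm i)]
  have key : ∑ i ∈ Finset.range n, (W (b i - m i) - W (a i - m i)) ≤ W (c + 1) - W c := by
    refine sum_sub_le_of_Ioo_disjoint hW (Finset.range n) (fun i => a i - m i) (fun i => b i - m i)
      c (c + 1) (by linarith) ?_ ?_ ?_ ?_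
    · intro i hi
      have := hab i (Finset.mem_range.1 hi)
      simpa using this
    · intro i _
      have := Int.floor_le (a i - c)
      simp only [hm]; linarith
    · intro i hi
      have hi' := Finset.mem_range.1 hi
      rcases eq_or_ne i 0 with rfl | hi0
      · simp only [hm0, Int.cast_zero, sub_zero]
        exact hone 0 hi'
      -- An arc reaching beyond `c + 1` would overlap the translate of arc `0` that begins there.
      · by_contra! hlt
        have h1 := Int.lt_floor_add_one (a i - c)
        have h1' : a i - m i < c + 1 := by simp only [hm]; linarith
        have h0 := hab 0 hn
        obtain ⟨t, ht1, ht2⟩ := exists_between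
          (show c + 1 < min (b i - m i) (b 0 + 1) from lt_min hlt (by linarith))
        rw [lt_min_iff] at ht2
        refine hdisj i hi' 0 hn hi0 (t + m i) ⟨by linarith, by linarith⟩ (t - 1)
          ⟨by linarith, by linarith⟩ (m i + 1) ?_
        push_cast; ring
    · intro i hi j hj hij
      rw [Set.disjoint_left]
      rintro x ⟨hx1, hx2⟩ ⟨hx3, hx4⟩
      refine hdisj i (Finset.mem_range.1 hi) j (Finset.mem_range.1 hj) hij (x + m i)
        ⟨by linarith, by linarith⟩ (x + m j) ⟨by linarith, by linarith⟩ (m i - m j) ?_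
      push_cast; ring
  have := hV c
  linarith

section Variation

variable {φ : ℝ → ℝ}

theorem eVariationOn_Icc_add_int (hφ : Function.Periodic φ 1) (a b : ℝ) (m : ℤ) :
    eVariationOn φ (Icc (a + m) (b + m)) = eVariationOn φ (Icc a b) := by
  have h1 : (fun x : ℝ => x + m) '' Icc a b = Icc (a + m) (b + m) := by simp
  have h2 : φ ∘ (fun x : ℝ => x + m) = φ := by
    funext x
    have := hφ.int_mul m x
    simpa using this
  rw [← h1, ← eVariationOn.comp_eq_of_monotoneOn φ _
    (fun x _ y _ hxy => by simpa using hxy : MonotoneOn (fun x : ℝ => x + m) (Icc a b)), h2]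

theorem eVariationOn_Icc_add {a b c : ℝ} (hab : a ≤ b) (hbc : b ≤ c) :
    eVariationOn φ (Icc a b) + eVariationOn φ (Icc b c) = eVariationOn φ (Icc a c) := by
  have := eVariationOn.Icc_add_Icc φ (s := univ) hab hbc (mem_univ b)
  simpa using this

theorem eVariationOn_Icc_add_one (hφ : Function.Periodic φ 1) (x : ℝ) :
    eVariationOn φ (Icc x (x + 1)) = eVariationOn φ (Icc 0 1) := by
  have h1 := Int.floor_le x
  have h2 := Int.lt_floor_add_one x
  rw [← eVariationOn_Icc_add h2.le (by linarith : (⌊x⌋ : ℝ) + 1 ≤ x + 1)]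
  have h3 := eVariationOn_Icc_add_int hφ (⌊x⌋ : ℝ) x 1
  have h4 := eVariationOn_Icc_add_int hφ 0 1 ⌊x⌋
  rw [zero_add, add_comm 1] at h4
  push_cast at h3
  rw [h3, add_comm, eVariationOn_Icc_add h1 h2.le, h4]

/-- Writing variation as the increment of a monotone function on the line reduces sums of variations
over disjoint arcs to `sum_sub_le_of_disjointArcs`. -/
theorem exists_variation_majorant (hφ : Function.Periodic φ 1)
    (hfin : eVariationOn φ (Icc 0 1) ≠ ⊤) :
    ∃ W : ℝ → ℝ, Monotone W ∧ (∀ x, W (x + 1) = W x + (eVariationOn φ (Icc 0 1)).toReal) ∧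
      ∀ x y, x ≤ y → |φ x - φ y| ≤ W y - W x := by
  have hnat : ∀ n : ℕ, eVariationOn φ (Icc 0 (n : ℝ)) ≠ ⊤ := by
    intro n
    induction n with
    | zero => simp
    | succ n ih =>
      push_cast
      rw [← eVariationOn_Icc_add (Nat.cast_nonneg n) (by linarith : (n : ℝ) ≤ n + 1),
        eVariationOn_Icc_add_one hφ]
      exact ENNReal.add_ne_top.2 ⟨ih, hfin⟩
  have hloc : LocallyBoundedVariationOn φ univ := by
    intro a b _ _
    obtain ⟨n, hn⟩ := exists_nat_ge (b - ⌊a⌋)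
    have h0 := Int.floor_le a
    rw [univ_inter]
    refine BoundedVariationOn.mono (t := Icc a b) (s := Icc (0 + (⌊a⌋ : ℝ)) (n + (⌊a⌋ : ℝ))) ?_
      (Icc_subset_Icc (by linarith) (by linarith))
    rw [BoundedVariationOn, eVariationOn_Icc_add_int hφ]
    exact hnat n
  refine ⟨variationOnFromTo φ univ 0, ?_, ?_, ?_⟩
  · intro x y hxy
    exact variationOnFromTo.monotoneOn hloc (mem_univ _) (mem_univ x) (mem_univ y) hxy
  · intro x
    rw [← variationOnFromTo.add hloc (mem_univ 0) (mem_univ x) (mem_univ (x + 1)),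
      variationOnFromTo.eq_of_le φ univ (by linarith : x ≤ x + 1), univ_inter,
      eVariationOn_Icc_add_one hφ]
  · intro x y hxy
    rw [← variationOnFromTo.add hloc (mem_univ 0) (mem_univ x) (mem_univ y), add_sub_cancel_left,
      variationOnFromTo.eq_of_le φ univ hxy]
    have h := eVariationOn.edist_le φ (s := univ ∩ Icc x y) (x := x) (y := y) (by simpa using hxy)
      (by simpa using hxy)
    rw [edist_dist, Real.dist_eq] at h
    exact (ENNReal.ofReal_le_iff_le_toReal (hloc x y (mem_univ _) (mem_univ _))).1 h

end Variation

section Lift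

variable {F : CircleDeg1Lift} {f : UnitAddCircle ≃ₜ UnitAddCircle}

theorem IsLift.injective (hF : IsLift F f) : Function.Injective F := by
  intro x y hxy
  have h1 : (x : UnitAddCircle) = y := f.injective (by rw [hF, hF, hxy])
  obtain ⟨m, rfl⟩ := (coe_eq_coe_iff _ _).1 h1
  rw [F.map_add_int] at hxy
  linarith

theorem IsLift.surjective (hF : IsLift F f) : Function.Surjective F := by
  intro y
  obtain ⟨c, hc⟩ := f.surjective (y : UnitAddCircle)
  obtain ⟨x, rfl⟩ := QuotientAddGroup.mk_surjective c
  have h1 : ((F x : ℝ) : UnitAddCircle) = y := by rw [← hF]; exact hc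
  obtain ⟨m, hm⟩ := (coe_eq_coe_iff _ _).1 h1
  refine ⟨x - m, ?_⟩
  rw [F.map_sub_int]
  linarith

theorem IsLift.strictMono (hF : IsLift F f) : StrictMono F :=
  F.strictMono_iff_injective.2 hF.injective

theorem iterate_add_int (F : CircleDeg1Lift) (k : ℕ) (x : ℝ) (m : ℤ) :
    F^[k] (x + m) = F^[k] x + m := by
  rw [← CircleDeg1Lift.coe_pow, CircleDeg1Lift.map_add_int]

theorem CyclicLift.iterate {z : Fin 4 → ℝ} (hF : StrictMono F) (hz : CyclicLift z) (k : ℕ) :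
    CyclicLift (fun i => F^[k] (z i)) := by
  obtain ⟨h1, h2, h3, h4⟩ := hz
  have hm := hF.iterate k
  refine ⟨hm h1, hm h2, hm h3, ?_⟩
  have := hm h4
  have h5 := iterate_add_int F k (z 0) 1
  push_cast at h5
  linarith

theorem IsSmall.disjointArcs {r : ℕ} {z : Fin 4 → ℝ} (h : IsSmall F r z) :
    DisjointArcs r (fun i => F^[i] (z 0)) (fun i => F^[i] (z 3)) := by
  intro i hi j hj hij x hx y hy m hxy
  have := h i hi j hj hij
  exact Set.disjoint_left.1 this ⟨x, hx, rfl⟩ ⟨y, hy, ((coe_eq_coe_iff _ _).2 ⟨m, hxy⟩).symm⟩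

theorem CyclicLift.lt {z : Fin 4 → ℝ} (hz : CyclicLift z) : z 0 < z 3 :=
  hz.1.trans (hz.2.1.trans hz.2.2.1)

theorem sum_sub_le_of_isSmall {W : ℝ → ℝ} (hW : Monotone W) {V : ℝ}
    (hV : ∀ x, W (x + 1) = W x + V) (hF : StrictMono F) {r : ℕ} {z : Fin 4 → ℝ}
    (hz : CyclicLift z) (h : IsSmall F r z) :
    ∑ i ∈ Finset.range r, (W (F^[i] (z 3)) - W (F^[i] (z 0))) ≤ V :=
  sum_sub_le_of_disjointArcs hW hV r _ _ (fun i _ => (hz.iterate hF i).lt)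
    (fun i _ => (hz.iterate hF i).2.2.2.le) h.disjointArcs

theorem image_coe_Ioo_lift (hF : IsLift F f) (a b : ℝ) :
    (fun t : ℝ => (t : UnitAddCircle)) '' Ioo (F a) (F b) =
      f '' ((fun t : ℝ => (t : UnitAddCircle)) '' Ioo a b) := by
  ext c
  constructor
  · rintro ⟨y, hy, rfl⟩
    obtain ⟨x, rfl⟩ := hF.surjective y
    exact ⟨x, ⟨x, ⟨hF.strictMono.lt_iff_lt.1 hy.1, hF.strictMono.lt_iff_lt.1 hy.2⟩, rfl⟩, hF x⟩
  · rintro ⟨_, ⟨x, hx, rfl⟩, rfl⟩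
    exact ⟨F x, ⟨hF.strictMono hx.1, hF.strictMono hx.2⟩, (hF x).symm⟩

theorem image_coe_Ioo_iterate (hF : IsLift F f) (k : ℕ) (a b : ℝ) :
    (fun t : ℝ => (t : UnitAddCircle)) '' Ioo (F^[k] a) (F^[k] b) =
      f^[k] '' ((fun t : ℝ => (t : UnitAddCircle)) '' Ioo a b) := by
  induction k with
  | zero => simp
  | succ k ih =>
    simp only [Function.iterate_succ_apply']
    rw [image_coe_Ioo_lift hF, ih, ← image_comp]
    rfl

/-- Supplies disjointness for the map whose covered set of break points is empty, where regularity
gives no information. -/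
theorem isSmall_conj_iff {F₁ F₂ H : CircleDeg1Lift} {f₁ f₂ h : UnitAddCircle ≃ₜ UnitAddCircle}
    (hF₁ : IsLift F₁ f₁) (hF₂ : IsLift F₂ f₂) (hH : IsLift H h) (hconj : ∀ x, h (f₁ x) = f₂ (h x))
    (r : ℕ) (z : Fin 4 → ℝ) : IsSmall F₂ r (fun i => H (z i)) ↔ IsSmall F₁ r z := by
  have hs : ∀ k, f₂^[k] ∘ h = h ∘ f₁^[k] := fun k =>
    ((Function.Semiconj.iterate_right (f := h) (ga := f₁) (gb := f₂) hconj k).comp_eq).symm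
  have : ∀ k : ℕ, (fun t : ℝ => (t : UnitAddCircle)) '' Ioo (F₂^[k] (H (z 0))) (F₂^[k] (H (z 3))) =
      h '' ((fun t : ℝ => (t : UnitAddCircle)) '' Ioo (F₁^[k] (z 0)) (F₁^[k] (z 3))) := by
    intro k
    rw [image_coe_Ioo_iterate hF₂, image_coe_Ioo_lift hH, image_coe_Ioo_iterate hF₁,
      image_image, image_image, image_image, image_image]
    exact image_congr fun t _ => congrFun (hs k) t
  simp only [IsSmall, this, disjoint_image_iff h.injective]

theorem cyclicLift_conj_iff {H : CircleDeg1Lift} (hH : StrictMono H) (z : Fin 4 → ℝ) :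
    CyclicLift (fun i => H (z i)) ↔ CyclicLift z := by
  simp only [CyclicLift, ← H.map_add_one, hH.lt_iff_lt]

end Lift

end

/-! ### One-sided derivatives and bounded distortion. -/

section

section Deriv

variable {F : CircleDeg1Lift}

theorem hasDerivWithinAt_add_int (F : CircleDeg1Lift) {s : Set ℝ} {x d : ℝ} (m : ℤ)
    (h : HasDerivWithinAt F d s x) :
    HasDerivWithinAt F d ((fun y : ℝ => y - m) ⁻¹' s) (x + m) := by
  have h1 : HasDerivWithinAt (fun y : ℝ => y - m) 1 ((fun y : ℝ => y - m) ⁻¹' s) (x + m) :=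
    (hasDerivWithinAt_id _ _).sub_const _
  have h2 : HasDerivWithinAt F d s ((fun y : ℝ => y - m) (x + m)) := by simpa using h
  have h3 := (h2.comp (x + m) h1 (mapsTo_preimage _ _)).add_const (m : ℝ)
  rw [mul_one] at h3
  refine h3.congr (fun y _ => ?_) ?_ <;> simp

theorem IsPHomeo.hasDerivWithinAt_right (hP : IsPHomeo F) (x : ℝ) :
    HasDerivWithinAt F (rightDeriv F x) (Ici x) x := (hP.right_diff x).hasDerivWithinAt

theorem IsPHomeo.hasDerivWithinAt_left (hP : IsPHomeo F) (x : ℝ) :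
    HasDerivWithinAt F (leftDeriv F x) (Iic x) x := (hP.left_diff x).hasDerivWithinAt

theorem IsPHomeo.rightDeriv_add_int (hP : IsPHomeo F) (x : ℝ) (m : ℤ) :
    rightDeriv F (x + m) = rightDeriv F x := by
  have h := hasDerivWithinAt_add_int F m (hP.hasDerivWithinAt_right x)
  have h2 : (fun y : ℝ => y - m) ⁻¹' Ici x = Ici (x + m) := by
    ext y; simp
  rw [h2] at h
  exact h.derivWithin (uniqueDiffOn_Ici _ _ self_mem_Ici)

theorem IsPHomeo.leftDeriv_add_int (hP : IsPHomeo F) (x : ℝ) (m : ℤ) :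
    leftDeriv F (x + m) = leftDeriv F x := by
  have h := hasDerivWithinAt_add_int F m (hP.hasDerivWithinAt_left x)
  have h2 : (fun y : ℝ => y - m) ⁻¹' Iic x = Iic (x + m) := by
    ext y; simp
  rw [h2] at h
  exact h.derivWithin (uniqueDiffOn_Iic _ _ self_mem_Iic)

theorem mem_breakSet_iff (F : CircleDeg1Lift) (x : ℝ) :
    (x : UnitAddCircle) ∈ breakSet F ↔ ¬ DifferentiableAt ℝ F x := by
  constructor
  · rintro ⟨y, hy, hd⟩ hx
    obtain ⟨m, rfl⟩ := (coe_eq_coe_iff _ _).1 hy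
    have := hasDerivWithinAt_add_int F m hx.hasDerivAt.hasDerivWithinAt (s := univ)
    rw [preimage_univ, hasDerivWithinAt_univ] at this
    exact hd this.differentiableAt
  · exact fun h => ⟨x, rfl, h⟩

theorem IsPHomeo.rightDeriv_pos (hP : IsPHomeo F) (x : ℝ) : 0 < rightDeriv F x := by
  obtain ⟨c₁, c₂, h1, _, h2⟩ := hP.bounds
  exact h1.trans (h2 x).2.1

theorem IsPHomeo.leftDeriv_pos (hP : IsPHomeo F) (x : ℝ) : 0 < leftDeriv F x := by
  obtain ⟨c₁, c₂, h1, _, h2⟩ := hP.bounds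
  exact h1.trans (h2 x).1.1

theorem IsPHomeo.jump_pos (hP : IsPHomeo F) (b : UnitAddCircle) : 0 < jump F b :=
  div_pos (hP.leftDeriv_pos _) (hP.rightDeriv_pos _)

theorem IsPHomeo.jump_coe (hP : IsPHomeo F) (x : ℝ) :
    jump F (x : UnitAddCircle) = leftDeriv F x / rightDeriv F x := by
  have h : ((AddCircle.equivIco (1 : ℝ) 0 (x : UnitAddCircle) : ℝ) : UnitAddCircle) = x :=
    (AddCircle.equivIco (1 : ℝ) 0).symm_apply_apply (x : UnitAddCircle)
  obtain ⟨m, hm⟩ := (coe_eq_coe_iff _ _).1 h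
  rw [jump, hm, hP.leftDeriv_add_int, hP.rightDeriv_add_int]

theorem IsPHomeo.jumpProd_pos (hP : IsPHomeo F) (B : Set UnitAddCircle) : 0 < jumpProd F B :=
  finprod_induction (p := fun t : ℝ => 0 < t) one_pos (fun _ _ => mul_pos) fun b =>
    finprod_induction (p := fun t : ℝ => 0 < t) one_pos (fun _ _ => mul_pos) fun _ => hP.jump_pos b

theorem IsPHomeo.continuous (hP : IsPHomeo F) : Continuous F :=
  continuous_iff_continuousAt.2 fun x => continuousAt_iff_continuous_left_right.2
    ⟨(hP.left_diff x).continuousWithinAt, (hP.right_diff x).continuousWithinAt⟩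

/-- A mean value inequality with right derivatives alone passes through break points without
splitting the interval. -/
theorem IsPHomeo.sub_le_of_rightDeriv_le (hP : IsPHomeo F) {x y C : ℝ} (hxy : x ≤ y)
    (h : ∀ t ∈ Ico x y, rightDeriv F t ≤ C) : F y - F x ≤ C * (y - x) := by
  have hB : ∀ t, HasDerivAt (fun t : ℝ => F x + C * (t - x)) C t := fun t => by
    simpa using (((hasDerivAt_id t).sub_const x).const_mul C).const_add (F x)
  have := image_le_of_deriv_right_le_deriv_boundary (f := F) (f' := rightDeriv F) (a := x) (b := y)
    (B := fun t => F x + C * (t - x)) (B' := fun _ => C) hP.continuous.continuousOn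
    (fun t _ => hP.hasDerivWithinAt_right t) (by simp)
    (fun t _ => (hB t).continuousAt.continuousWithinAt) (fun t _ => (hB t).hasDerivWithinAt)
    h (right_mem_Icc.2 hxy)
  linarith

theorem IsPHomeo.le_sub_of_le_rightDeriv (hP : IsPHomeo F) {x y C : ℝ} (hxy : x ≤ y)
    (h : ∀ t ∈ Ico x y, C ≤ rightDeriv F t) : C * (y - x) ≤ F y - F x := by
  have hB : ∀ t, HasDerivAt (fun t : ℝ => F x + C * (t - x)) C t := fun t => by
    simpa using (((hasDerivAt_id t).sub_const x).const_mul C).const_add (F x)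
  have := image_le_of_deriv_right_le_deriv_boundary (f := fun t => F x + C * (t - x))
    (f' := fun _ => C) (a := x) (b := y)
    (B := F) (B' := rightDeriv F) (fun t _ => (hB t).continuousAt.continuousWithinAt)
    (fun t _ => (hB t).hasDerivWithinAt) (by simp)
    hP.continuous.continuousOn (fun t _ => hP.hasDerivWithinAt_right t)
    h (right_mem_Icc.2 hxy)
  linarith

theorem IsPHomeo.strictMono (hP : IsPHomeo F) : StrictMono F := by
  obtain ⟨c₁, c₂, h1, _, h2⟩ := hP.bounds
  intro x y hxy
  have := hP.le_sub_of_le_rightDeriv hxy.le (fun t _ => (h2 t).2.1.le)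
  have := mul_pos h1 (sub_pos.2 hxy)
  linarith

theorem IsPHomeo.iterate_sub_pos (hP : IsPHomeo F) (k : ℕ) {x y : ℝ} (hxy : x < y) :
    0 < F^[k] y - F^[k] x := sub_pos.2 (hP.strictMono.iterate k hxy)

end Deriv

/-- `W` is a monotone majorant of the variation of `log DF`, whose increment over one period is
`V`. -/
structure IsMajorant (F : CircleDeg1Lift) (W : ℝ → ℝ) (V : ℝ) : Prop where
  mono : Monotone W
  map_add_one : ∀ x, W (x + 1) = W x + V
  abs_sub_le : ∀ x y, x ≤ y →
    |Real.log (rightDeriv F x) - Real.log (rightDeriv F y)| ≤ W y - W x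

variable {F : CircleDeg1Lift}

theorem IsPHomeo.exists_isMajorant (hP : IsPHomeo F) :
    ∃ W, IsMajorant F W (logVar F).toReal := by
  obtain ⟨W, h1, h2, h3⟩ := exists_variation_majorant
    (φ := fun x : ℝ => Real.log (rightDeriv F x)) (fun x => by
      have := hP.rightDeriv_add_int x 1
      push_cast at this
      simp only [this]) hP.bounded_variation
  exact ⟨W, h1, h2, h3⟩

variable {W : ℝ → ℝ} {V : ℝ}

theorem IsMajorant.rightDeriv_le (hP : IsPHomeo F) (hW : IsMajorant F W V) {a b s t : ℝ}
    (hs : s ∈ Icc a b) (ht : t ∈ Icc a b) :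
    rightDeriv F s ≤ Real.exp (W b - W a) * rightDeriv F t := by
  have key : Real.log (rightDeriv F s) - Real.log (rightDeriv F t) ≤ W b - W a := by
    rcases le_total s t with h | h
    · have h1 := (le_abs_self _).trans (hW.abs_sub_le s t h)
      have := hW.mono hs.1
      have := hW.mono ht.2
      linarith
    · have h1 := hW.abs_sub_le t s h
      rw [abs_sub_comm] at h1
      have := (le_abs_self _).trans h1
      have := hW.mono ht.1
      have := hW.mono hs.2
      linarith
  have h1 : Real.log (rightDeriv F s) ≤ (W b - W a) + Real.log (rightDeriv F t) := by linarith
  rw [← Real.exp_le_exp, Real.exp_add, Real.exp_log (hP.rightDeriv_pos s),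
    Real.exp_log (hP.rightDeriv_pos t)] at h1
  exact h1

/-- Logarithms of difference quotients over subintervals of `[a, b]` differ at most by the
variation. -/
theorem IsMajorant.log_sub_le (hP : IsPHomeo F) (hW : IsMajorant F W V) {a b u v u' v' : ℝ}
    (hau : a ≤ u) (huv : u < v) (hvb : v ≤ b) (hau' : a ≤ u') (huv' : u' < v') (hvb' : v' ≤ b) :
    (Real.log (F v - F u) - Real.log (v - u)) - (Real.log (F v' - F u') - Real.log (v' - u'))
      ≤ W b - W a := by
  have hE := Real.exp_pos (W b - W a)
  have h1 : ∀ t ∈ Icc a b, F v - F u ≤ (Real.exp (W b - W a) * rightDeriv F t) * (v - u) :=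
    fun t ht => hP.sub_le_of_rightDeriv_le huv.le fun s hs =>
      hW.rightDeriv_le hP ⟨hau.trans hs.1, hs.2.le.trans hvb⟩ ht
  have hvu := sub_pos.2 huv
  have hvu' := sub_pos.2 huv'
  have hF := sub_pos.2 (hP.strictMono huv)
  have hF' := sub_pos.2 (hP.strictMono huv')
  have h2 : (F v - F u) / (v - u) / Real.exp (W b - W a) * (v' - u') ≤ F v' - F u' := by
    refine hP.le_sub_of_le_rightDeriv huv'.le fun t ht => ?_
    have := h1 t ⟨hau'.trans ht.1, ht.2.le.trans hvb'⟩
    rw [div_le_iff₀ hE, div_le_iff₀ hvu]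
    linarith
  have h3 : (F v - F u) / (v - u) ≤ Real.exp (W b - W a) * ((F v' - F u') / (v' - u')) := by
    rw [← le_div_iff₀ hvu', div_le_iff₀ hE] at h2
    linarith
  have h4 := Real.log_le_log (div_pos hF hvu) h3
  rw [Real.log_mul hE.ne' (div_pos hF' hvu').ne', Real.log_exp, Real.log_div hF.ne' hvu.ne',
    Real.log_div hF'.ne' hvu'.ne'] at h4
  linarith

/-- Bounded distortion along an orbit of non-overlapping arcs. -/
theorem IsMajorant.log_iterate_sub_le (hP : IsPHomeo F) (hW : IsMajorant F W V) {r : ℕ}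
    {z : Fin 4 → ℝ} (hz : CyclicLift z) (hs : IsSmall F r z) {j : ℕ} (hj : j ≤ r)
    {u v u' v' : ℝ}
    (hau : z 0 ≤ u) (huv : u < v) (hvb : v ≤ z 3) (hau' : z 0 ≤ u') (huv' : u' < v')
    (hvb' : v' ≤ z 3) :
    (Real.log (F^[j] v - F^[j] u) - Real.log (v - u)) -
      (Real.log (F^[j] v' - F^[j] u') - Real.log (v' - u')) ≤ V := by
  have hm := fun i : ℕ => (hP.strictMono.iterate i)
  -- Summed over the orbit, the left sides telescope, while the right sides are increments of `W`
  -- over disjoint arcs.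
  have h1 : ∀ i ∈ Finset.range j, _ := fun i (_ : i ∈ Finset.range j) =>
    hW.log_sub_le hP ((hm i).monotone hau) (hm i huv) ((hm i).monotone hvb)
      ((hm i).monotone hau') (hm i huv') ((hm i).monotone hvb')
  have h2 := Finset.sum_le_sum h1
  have h3 : ∑ i ∈ Finset.range j, (W (F^[i] (z 3)) - W (F^[i] (z 0))) ≤ V := by
    refine (Finset.sum_le_sum_of_subset_of_nonneg (Finset.range_subset_range.2 hj) ?_).trans
      (sum_sub_le_of_isSmall hW.mono hW.map_add_one hP.strictMono hz hs)
    intro i _ _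
    exact sub_nonneg.2 (hW.mono ((hm i).monotone hz.lt.le))
  refine le_trans (le_of_eq ?_) (h2.trans h3)
  rw [Finset.sum_sub_distrib]
  simp only [← Function.iterate_succ_apply' F]
  rw [Finset.sum_range_sub (fun i => Real.log (F^[i] v - F^[i] u)),
    Finset.sum_range_sub (fun i => Real.log (F^[i] v' - F^[i] u'))]
  simp

theorem IsMajorant.div_iterate_le (hP : IsPHomeo F) (hW : IsMajorant F W V) {r : ℕ}
    {z : Fin 4 → ℝ} (hz : CyclicLift z) (hs : IsSmall F r z) {j : ℕ} (hj : j ≤ r)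
    {u v u' v' : ℝ}
    (hau : z 0 ≤ u) (huv : u < v) (hvb : v ≤ z 3) (hau' : z 0 ≤ u') (huv' : u' < v')
    (hvb' : v' ≤ z 3) :
    (F^[j] v - F^[j] u) / (F^[j] v' - F^[j] u') ≤ Real.exp V * ((v - u) / (v' - u')) := by
  have h := hW.log_iterate_sub_le hP hz hs hj hau huv hvb hau' huv' hvb'
  have h1 := hP.iterate_sub_pos j huv
  have h2 := hP.iterate_sub_pos j huv'
  have h3 := sub_pos.2 huv
  have h4 := sub_pos.2 huv'
  rw [← Real.log_le_log_iff (div_pos h1 h2) (by positivity), Real.log_div h1.ne' h2.ne',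
    Real.log_mul (Real.exp_pos V).ne' (div_pos h3 h4).ne', Real.log_exp, Real.log_div h3.ne' h4.ne']
  linarith

end

/-! ### Denjoy's theorem and uniform smallness of the arcs. -/

section

/-- An irrational number has arbitrarily large times of closest return to the integers. -/
theorem exists_closest_return {t : ℝ} (ht : Irrational t) (N : ℕ) :
    ∃ q > N, ∃ p : ℤ, ∀ k : ℕ, 0 < k → k < q → ∀ m : ℤ, |q * t - p| < |k * t - m| := by
  classical
  have hpos : ∀ k : ℕ, 0 < k → 0 < |k * t - round (k * t)| := by
    intro k hk
    have := (ht.natCast_mul hk.ne').ne_int (round (k * t))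
    exact abs_pos.2 (sub_ne_zero.2 this)
  obtain ⟨e, he, hle⟩ : ∃ e > 0, ∀ k : ℕ, 0 < k → k ≤ N → e ≤ |k * t - round (k * t)| := by
    induction N with
    | zero => exact ⟨1, one_pos, fun k h1 h2 => by omega⟩
    | succ N ih =>
      obtain ⟨e, he, h⟩ := ih
      refine ⟨min e _, lt_min he (hpos (N + 1) N.succ_pos), fun k h1 h2 => ?_⟩
      rcases Nat.lt_or_ge N k with h3 | h3
      · obtain rfl : k = N + 1 := by omega
        exact min_le_right _ _
      · exact (min_le_left _ _).trans (h k h1 h3)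
  have hex : ∃ k : ℕ, 0 < k ∧ |k * t - round (k * t)| < e := by
    obtain ⟨n, hn⟩ := exists_nat_one_div_lt he
    obtain ⟨k, h1, _, h3⟩ := Real.exists_nat_abs_mul_sub_round_le t n.succ_pos
    refine ⟨k, h1, h3.trans_lt (lt_of_le_of_lt ?_ hn)⟩
    push_cast
    exact one_div_le_one_div_of_le (by positivity) (by linarith)
  obtain ⟨h1, h2⟩ := Nat.find_spec hex
  -- The first time that beats `e` is a closest return; it exceeds `N` because no `k ≤ N` beats `e`.
  refine ⟨Nat.find hex, ?_, round (Nat.find hex * t), fun k hk hkq m => ?_⟩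
  · by_contra! h
    exact absurd h2 (not_lt.2 (hle _ h1 h))
  · have h3 := Nat.find_min hex hkq
    push Not at h3
    exact h2.trans_le ((h3 hk).trans (round_le _ _))

variable {F : CircleDeg1Lift}

theorem IsPHomeo.bijective (hP : IsPHomeo F) : Function.Bijective F :=
  ⟨hP.strictMono.injective, F.continuous_iff_surjective.1 hP.continuous⟩

theorem IsPHomeo.exists_semiconj (hP : IsPHomeo F) :
    ∃ Φ : CircleDeg1Lift, ∀ x, Φ (F x) = Φ x + F.translationNumber := by
  obtain ⟨Φ, hΦ⟩ := CircleDeg1Lift.semiconj_of_bijective_of_translationNumber_eq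
    (f₁ := F) (f₂ := CircleDeg1Lift.translate (Multiplicative.ofAdd F.translationNumber))
    hP.bijective (CircleDeg1Lift.isUnit_iff_bijective.1 (Units.isUnit _))
    (CircleDeg1Lift.translationNumber_translate _).symm
  refine ⟨Φ, fun x => ?_⟩
  rw [hΦ x, CircleDeg1Lift.translate_apply, add_comm]

theorem semiconj_iterate {Φ : CircleDeg1Lift} {T : ℝ → ℝ} {t : ℝ} (h : ∀ x, Φ (T x) = Φ x + t)
    (k : ℕ) (x : ℝ) : Φ (T^[k] x) = Φ x + k * t := by
  induction k with
  | zero => simp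
  | succ k ih =>
    rw [Function.iterate_succ_apply', h, ih]
    push_cast
    ring

/-- `Φ` collapses the `k`-th image to the point `Φ a + k t`. These points are distinct mod `1` as
`t` is irrational, so the images are disjoint and their lengths summable. `T` is general in order to
cover both `F` and its inverse. -/
theorem tendsto_iterate_sub_of_wandering {Φ : CircleDeg1Lift} {T : ℝ → ℝ} {t : ℝ}
    (h : ∀ x, Φ (T x) = Φ x + t) (hT : StrictMono T) (ht : Irrational t) {a b : ℝ} (hab : a < b)
    (hΦ : Φ a = Φ b) : Tendsto (fun k => T^[k] b - T^[k] a) atTop (𝓝 0) := by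
  have hmem : ∀ k, ∀ x ∈ Icc (T^[k] a) (T^[k] b), Φ x = Φ a + k * t := by
    intro k x hx
    have h1 := Φ.monotone hx.1
    have h2 := Φ.monotone hx.2
    rw [semiconj_iterate h] at h1 h2
    linarith
  have hpos : ∀ k, 0 < T^[k] b - T^[k] a := fun k => sub_pos.2 (hT.iterate k hab)
  have hsum : ∀ n, ∑ k ∈ Finset.range n, (T^[k] b - T^[k] a) ≤ 1 := by
    intro n
    refine sum_sub_le_of_disjointArcs (W := id) monotone_id (fun _ => rfl) n (fun k => T^[k] a)
      (fun k => T^[k] b) (fun k _ => hT.iterate k hab) ?_ ?_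
    · intro k _
      by_contra! hlt
      have h1 := hmem k (T^[k] a + 1) ⟨by linarith, hlt.le⟩
      rw [Φ.map_add_one, semiconj_iterate h] at h1
      linarith
    · intro i _ j _ hij x hx y hy m hxy
      have h1 := hmem i x (Ioo_subset_Icc_self hx)
      rw [hxy, Φ.map_add_int, hmem j y (Ioo_subset_Icc_self hy)] at h1
      have h2 : ((i : ℤ) - j : ℤ) * t = m := by push_cast; linarith
      exact (ht.intCast_mul (sub_ne_zero.2 (by exact_mod_cast hij))).ne_int m h2
  exact (summable_of_sum_range_le (fun k => (hpos k).le) hsum).tendsto_atTop_zero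

/-- Denjoy's inequality for the iterates of a wandering interval. -/
theorem IsMajorant.denjoy_inequality (hP : IsPHomeo F) {W : ℝ → ℝ} {V : ℝ}
    (hW : IsMajorant F W V) {Φ : CircleDeg1Lift} (hΦF : ∀ x, Φ (F x) = Φ x + F.translationNumber)
    {q : ℕ} (hq : 1 < q) {p : ℤ}
    (hqp : ∀ k : ℕ, 0 < k → k < q → ∀ m : ℤ,
      |q * F.translationNumber - p| < |k * F.translationNumber - m|)
    {a b : ℝ} (hab : a < b) (hΦ : Φ a = Φ b) :
    (F^[q] b - F^[q] a) * (F^[q] b - F^[q] a) ≤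
      Real.exp V * ((F^[q] (F^[q] b) - F^[q] (F^[q] a)) * (b - a)) := by
  set τ := F.translationNumber
  have hm := fun i : ℕ => (hP.strictMono.iterate i)
  -- `[lo k, hi k]` is the hull of the `k`-th image of `[a, b]` and of the `(k + q)`-th image
  -- shifted by `p`. Its `Φ`-image has width `|q τ - p|`, so closest return makes the hulls with `k
  -- < q` disjoint.
  set lo : ℕ → ℝ := fun k => min (F^[k] a) (F^[k] (F^[q] a) - p) with hlo
  set hi : ℕ → ℝ := fun k => max (F^[k] b) (F^[k] (F^[q] b) - p) with hhi
  have hlt : ∀ k, lo k < hi k := fun k =>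
    (min_le_left _ _).trans_lt ((hm k hab).trans_le (le_max_left _ _))
  have hΦlo : ∀ k, Φ (lo k) = Φ a + k * τ + min 0 (q * τ - p) := by
    intro k
    rw [hlo, Φ.monotone.map_min, Φ.map_sub_int, semiconj_iterate hΦF, semiconj_iterate hΦF,
      semiconj_iterate hΦF, ← min_add_add_left]
    congr 1 <;> ring
  have hΦhi : ∀ k, Φ (hi k) = Φ a + k * τ + max 0 (q * τ - p) := by
    intro k
    rw [hhi, Φ.monotone.map_max, Φ.map_sub_int, semiconj_iterate hΦF, semiconj_iterate hΦF,
      semiconj_iterate hΦF, ← max_add_add_left, hΦ]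
    congr 1 <;> ring
  have hwidth : max 0 (q * τ - p) - min 0 (q * τ - p) = |q * τ - p| := by
    rw [max_sub_min_eq_abs, sub_zero]
  have hdisj : DisjointArcs q lo hi := by
    have key : ∀ i j : ℕ, i < q → j < i → ∀ x ∈ Ioo (lo i) (hi i), ∀ y ∈ Ioo (lo j) (hi j),
        ∀ m : ℤ, x ≠ y + m := by
      intro i j hi hj x hx y hy m hxy
      have h1 := Φ.monotone hx.1.le
      have h2 := Φ.monotone hx.2.le
      have h3 := Φ.monotone hy.1.le
      have h4 := Φ.monotone hy.2.le
      rw [hΦlo] at h1 h3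
      rw [hΦhi] at h2 h4
      rw [hxy, Φ.map_add_int] at h1 h2
      have h5 := hqp (i - j) (by omega) (by omega) m
      rw [Nat.cast_sub hj.le, ← hwidth] at h5
      refine absurd h5 (not_lt.2 (abs_le.2 ⟨?_, ?_⟩)) <;> linarith
    intro i hi j hj hij x hx y hy m hxy
    rcases lt_or_gt_of_ne hij with h | h
    · exact key j i hj h y hy x hx (-m) (by push_cast; linarith)
    · exact key i j hi h x hx y hy m hxy
  have hone : ∀ k < q, hi k ≤ lo k + 1 := by
    intro k _
    by_contra! h
    have h1 := Φ.monotone h.le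
    rw [Φ.map_add_one, hΦlo, hΦhi] at h1
    have h2 := hqp 1 one_pos hq (round (((1 : ℕ) : ℝ) * τ))
    have h3 := h2.trans_le (abs_sub_round _)
    rw [← hwidth] at h3
    linarith
  have hsum := sum_sub_le_of_disjointArcs hW.mono hW.map_add_one q lo hi (fun k _ => hlt k) hone
    hdisj
  have hterm : ∀ k ∈ Finset.range q, _ := fun k (_ : k ∈ Finset.range q) =>
    hW.log_sub_le hP (u' := F^[k] (F^[q] a) - p) (v' := F^[k] (F^[q] b) - p)
      (min_le_left _ _ : lo k ≤ _) (hm k hab) (le_max_left _ _ : _ ≤ hi k) (min_le_right _ _)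
      (by have := hm k (hm q hab); linarith) (le_max_right _ _)
  have h1 := (Finset.sum_le_sum hterm).trans hsum
  simp only [F.map_sub_int, sub_sub_sub_cancel_right] at h1
  rw [Finset.sum_sub_distrib] at h1
  simp only [← Function.iterate_succ_apply' F] at h1
  rw [Finset.sum_range_sub (fun i => Real.log (F^[i] b - F^[i] a)),
    Finset.sum_range_sub (fun i => Real.log (F^[i] (F^[q] b) - F^[i] (F^[q] a)))] at h1
  simp only [Function.iterate_zero, id] at h1
  have p1 := sub_pos.2 hab
  have p2 := hP.iterate_sub_pos q hab
  have p3 := hP.iterate_sub_pos q (hm q hab)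
  rw [← Real.log_le_log_iff (mul_pos p2 p2) (by positivity), Real.log_mul p2.ne' p2.ne',
    Real.log_mul (Real.exp_pos V).ne' (mul_pos p3 p1).ne', Real.log_exp,
    Real.log_mul p3.ne' p1.ne']
  linarith

/-- Denjoy's theorem: a `P`-homeomorphism with irrational rotation number has no wandering
intervals, so that the semiconjugacy to the rotation is injective. -/
theorem IsPHomeo.strictMono_semiconj (hP : IsPHomeo F) (hirr : Irrational F.translationNumber)
    {Φ : CircleDeg1Lift} (hΦF : ∀ x, Φ (F x) = Φ x + F.translationNumber) : StrictMono Φ := by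
  refine Φ.monotone.strictMono_of_injective ?_
  by_contra hinj
  obtain ⟨a, b, hab, hΦ⟩ : ∃ a b, a < b ∧ Φ a = Φ b := by
    simp only [Function.Injective, not_forall] at hinj
    obtain ⟨a, b, h1, h2⟩ := hinj
    rcases lt_or_gt_of_ne h2 with h | h
    · exact ⟨a, b, h, h1⟩
    · exact ⟨b, a, h, h1.symm⟩
  obtain ⟨W, hW⟩ := hP.exists_isMajorant
  set V := (logVar F).toReal
  obtain ⟨G, hGl, hGr⟩ := Function.bijective_iff_has_inverse.1 hP.bijective
  have hG : StrictMono G := fun x y hxy => by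
    rw [← hGr x, ← hGr y] at hxy
    exact hP.strictMono.lt_iff_lt.1 hxy
  have hΦG : ∀ x, Φ (G x) = Φ x + -F.translationNumber := fun x => by
    have := hΦF (G x)
    rw [hGr] at this
    linarith
  have ht1 := tendsto_iterate_sub_of_wandering hΦF hP.strictMono hirr hab hΦ
  have ht2 := tendsto_iterate_sub_of_wandering hΦG hG hirr.neg hab hΦ
  have ht3 := (ht1.mul ht2).const_mul (Real.exp V)
  simp only [mul_zero] at ht3
  have hlen := sub_pos.2 hab
  obtain ⟨N, hN⟩ := eventually_atTop.1
    (ht3.eventually (gt_mem_nhds (mul_pos hlen hlen)))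
  obtain ⟨q, hqN, p, hqp⟩ := exists_closest_return hirr (max N 1)
  have hinv : ∀ x, F^[q] (G^[q] x) = x := Function.RightInverse.iterate hGr q
  -- For the interval `F^{-q} I`, `I = [a, b]`, Denjoy's inequality reads `|I|² ≤ e^V |F^q I|
  -- |F^{-q} I|`, and the right side tends to `0`.
  have h1 := hW.denjoy_inequality hP hΦF ((le_max_right N 1).trans_lt hqN) hqp (hG.iterate q hab)
    (by rw [semiconj_iterate hΦG, semiconj_iterate hΦG, hΦ])
  simp only [hinv] at h1
  exact absurd (hN q ((le_max_left N 1).trans hqN.le)) (not_lt.2 h1)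

/-- A strictly increasing lift expands all sufficiently long intervals by a definite amount. -/
theorem exists_le_map_sub {Φ : CircleDeg1Lift} (hΦ : StrictMono Φ) {e : ℝ} (he : 0 < e) :
    ∃ κ > 0, ∀ x y, x + e ≤ y → κ ≤ Φ y - Φ x := by
  obtain ⟨k, hk⟩ := exists_nat_one_div_lt (half_pos he)
  set n : ℕ := k + 1 with hn
  have hn0 : (0 : ℝ) < n := by positivity
  have hne : 1 / (n : ℝ) < e / 2 := by rw [hn]; push_cast; exact hk
  -- Increments over grid cells take finitely many values by periodicity, and any interval of length
  -- `e > 2 / n` contains a cell.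
  set g : ℤ → ℝ := fun i => Φ ((i + 1) / n) - Φ (i / n) with hg
  have hgpos : ∀ i, 0 < g i := fun i => sub_pos.2 (hΦ (by gcongr; linarith))
  have hgper : ∀ i : ℤ, g (i % n) = g i := by
    intro i
    have h0 : (i : ℝ) = n * (i / (n : ℤ) : ℤ) + (i % (n : ℤ) : ℤ) := by
      exact_mod_cast (Int.mul_ediv_add_emod i n).symm
    have h1 : ((i : ℝ) + 1) / n = ((i % (n : ℤ) : ℤ) + 1) / n + (i / (n : ℤ) : ℤ) := by
      rw [h0]; field_simp; ring
    have h2 : (i : ℝ) / n = (i % (n : ℤ) : ℤ) / n + (i / (n : ℤ) : ℤ) := by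
      rw [h0]; field_simp; ring
    simp only [hg, h1, h2, Φ.map_add_int]
    ring
  obtain ⟨i₀, hi₀, hmin⟩ := Finset.exists_min_image (Finset.Ico (0 : ℤ) n) g
    ⟨0, Finset.mem_Ico.2 ⟨le_rfl, by exact_mod_cast k.succ_pos⟩⟩
  refine ⟨g i₀, hgpos _, fun x y hxy => ?_⟩
  set i := ⌈x * n⌉ with hi
  have h1 : x ≤ i / n := by rw [le_div_iff₀ hn0]; exact Int.le_ceil _
  have h2 : ((i : ℝ) + 1) / n ≤ y := by
    have := Int.ceil_lt_add_one (x * n)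
    have h3 : ((i : ℝ) + 1) / n < x + 2 * (1 / n) := by
      rw [div_lt_iff₀ hn0]
      field_simp
      linarith
    linarith
  have h3 := hmin (i % n) (Finset.mem_Ico.2
    ⟨Int.emod_nonneg _ (by positivity), Int.emod_lt_of_pos _ (by positivity)⟩)
  rw [hgper] at h3
  have h4 := Φ.monotone h1
  have h5 := Φ.monotone h2
  simp only [hg] at h3 ⊢
  linarith

/-- All images of the arc have the same `Φ`-length, at most `1 / r`, hence the uniformity in `j`. -/
theorem IsPHomeo.exists_iterate_sub_lt (hP : IsPHomeo F) (hirr : Irrational F.translationNumber)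
    {e : ℝ} (he : 0 < e) :
    ∃ R : ℕ, ∀ r ≥ R, ∀ z : Fin 4 → ℝ, CyclicLift z → IsSmall F r z → ∀ j : ℕ,
      F^[j] (z 3) - F^[j] (z 0) < e := by
  obtain ⟨Φ, hΦF⟩ := hP.exists_semiconj
  have hΦ := hP.strictMono_semiconj hirr hΦF
  obtain ⟨κ, hκ, hexp⟩ := exists_le_map_sub hΦ he
  obtain ⟨R, hR⟩ := exists_nat_gt (1 / κ)
  refine ⟨R, fun r hr z hz hs j => ?_⟩
  by_contra! hlt
  have h1 := hexp (F^[j] (z 0)) (F^[j] (z 3)) (by linarith)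
  have h2 := sum_sub_le_of_isSmall Φ.monotone Φ.map_add_one hP.strictMono hz hs
  simp only [semiconj_iterate hΦF, add_sub_add_right_eq_sub] at h1 h2
  rw [Finset.sum_const, Finset.card_range, nsmul_eq_mul] at h2
  have h3 : 1 < κ * R := by
    rw [div_lt_iff₀ hκ] at hR
    linarith
  have h4 : (R : ℝ) ≤ r := by exact_mod_cast hr
  nlinarith [mul_le_mul h4 h1 hκ.le (Nat.cast_nonneg r)]

end

/-! ### One-step distortion on short arcs, with and without a break point. -/

section

theorem abs_log_sub_log_le {a b m : ℝ} (hm : 0 < m) (ha : m ≤ a) (hb : m ≤ b) :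
    |Real.log a - Real.log b| ≤ |a - b| / m := by
  have key : ∀ a b : ℝ, m ≤ a → m ≤ b → Real.log a - Real.log b ≤ |a - b| / m := by
    intro a b ha hb
    have ha' := hm.trans_le ha
    have hb' := hm.trans_le hb
    rw [← Real.log_div ha'.ne' hb'.ne']
    calc Real.log (a / b) ≤ a / b - 1 := Real.log_le_sub_one_of_pos (div_pos ha' hb')
      _ = (a - b) / b := by rw [sub_div, div_self hb'.ne']
      _ ≤ |a - b| / b := by gcongr; exact le_abs_self _
      _ ≤ |a - b| / m := by gcongr
  rw [abs_le]
  have h1 := key a b ha hb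
  have h2 := key b a hb ha
  rw [abs_sub_comm] at h2
  exact ⟨by linarith, h1⟩

variable {F : CircleDeg1Lift}

/-- Lifts of points of the circle that are not break points. -/
def regularSet (F : CircleDeg1Lift) : Set ℝ := {x : ℝ | (x : UnitAddCircle) ∉ breakSet F}

theorem differentiableAt_of_mem_regularSet {x : ℝ} (hx : x ∈ regularSet F) :
    DifferentiableAt ℝ F x := by
  have h : (x : UnitAddCircle) ∉ breakSet F := hx
  rwa [mem_breakSet_iff, not_not] at h

theorem rightDeriv_eq_deriv {x : ℝ} (hx : x ∈ regularSet F) : rightDeriv F x = deriv F x :=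
  (differentiableAt_of_mem_regularSet hx).derivWithin (uniqueDiffOn_Ici _ _ self_mem_Ici)

theorem IsPHomeo.isOpen_regularSet (hP : IsPHomeo F) : IsOpen (regularSet F) :=
  hP.finite_breaks.isClosed.isOpen_compl.preimage (AddCircle.continuous_mk' (1 : ℝ))

theorem norm_coe_le_abs (x : ℝ) : ‖(x : UnitAddCircle)‖ ≤ |x| := by
  rw [UnitAddCircle.norm_eq]
  simpa using round_le x 0

/-- Distinct lifts of break points keep a definite distance. -/
theorem IsPHomeo.exists_gap (hP : IsPHomeo F) :
    ∃ η > 0, ∀ s t : ℝ, s < t → s ∉ regularSet F → t ∉ regularSet F → η ≤ t - s := by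
  have := hP.finite_breaks.to_subtype
  obtain ⟨e, he, hle⟩ := ENNReal.lt_iff_exists_nnreal_btwn.1
    (Set.einfsep_pos_of_finite (s := breakSet F))
  refine ⟨min e 1, lt_min (by exact_mod_cast he) one_pos, fun s t hst hs ht => ?_⟩
  simp only [regularSet, mem_ofPred_eq, not_not] at hs ht
  by_cases heq : (t : UnitAddCircle) = s
  · obtain ⟨m, hm⟩ := (coe_eq_coe_iff _ _).1 heq
    have h1 : (0 : ℝ) < m := by linarith
    have h2 : (1 : ℤ) ≤ m := by exact_mod_cast h1
    have h3 : (1 : ℝ) ≤ m := by exact_mod_cast h2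
    exact (min_le_right _ _).trans (by linarith)
  · have h1 := hle.le.trans (Set.einfsep_le_edist_of_mem ht hs heq)
    rw [edist_dist, dist_eq_norm, ← AddCircle.coe_sub, ENNReal.le_ofReal_iff_toReal_le
      ENNReal.coe_ne_top (norm_nonneg _)] at h1
    have h2 := h1.trans (norm_coe_le_abs _)
    rw [abs_of_pos (sub_pos.2 hst)] at h2
    exact (min_le_left _ _).trans h2

/-- Uniform bounds for the derivatives of `F` off the break points. -/
structure SmoothBounds (F : CircleDeg1Lift) (c c' C α η : ℝ) : Prop where
  c_pos : 0 < c
  C_nonneg : 0 ≤ C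
  α_pos : 0 < α
  α_le : α ≤ 1
  η_pos : 0 < η
  le_right : ∀ x, c ≤ rightDeriv F x
  le_left : ∀ x, c ≤ leftDeriv F x
  right_le : ∀ x, rightDeriv F x ≤ c'
  hasDerivAt : ∀ x ∈ regularSet F, HasDerivAt (deriv F) (deriv (deriv F) x) x
  abs_le : ∀ x ∈ regularSet F, |deriv (deriv F) x| ≤ C
  holder : ∀ x y : ℝ, x < y → (∀ t ∈ Icc x y, t ∈ regularSet F) →
      |deriv (deriv F) x - deriv (deriv F) y| ≤ C * (y - x) ^ α
  gap : ∀ s t : ℝ, s < t → s ∉ regularSet F → t ∉ regularSet F → η ≤ t - s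

theorem exists_deriv_slope {g : ℝ → ℝ} {u v : ℝ} (huv : u < v) (hc : ContinuousOn g (Icc u v))
    (hd : DifferentiableOn ℝ g (Ioo u v)) : ∃ ξ ∈ Ioo u v, g v - g u = deriv g ξ * (v - u) := by
  obtain ⟨ξ, h1, h2⟩ := exists_deriv_eq_slope g huv hc hd
  refine ⟨ξ, h1, ?_⟩
  rw [h2, div_mul_cancel₀ _ (sub_pos.2 huv).ne']

/-- The bound on `D²F` follows from the others: the mean value theorem gives a point where it is at
most `2 c₂ / l`, and the Hölder condition carries this across a window of length `l`. -/
theorem IsPHomeo.exists_smoothBounds (hP : IsPHomeo F) (hC : IsPiecewiseC2Holder F) :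
    ∃ c c' C α η, SmoothBounds F c c' C α η := by
  obtain ⟨c₁, c₂, hc, _, hb⟩ := hP.bounds
  obtain ⟨α, C, hα, hα1, hcd, hh⟩ := hC
  obtain ⟨η, hη, hgap⟩ := hP.exists_gap
  have hd2 : ∀ x ∈ regularSet F, HasDerivAt (deriv F) (deriv (deriv F) x) x := by
    intro x hx
    have h1 : ContDiffOn ℝ (1 + 1) F (regularSet F) := by
      norm_num; exact hcd
    have h2 := ((contDiffOn_succ_iff_deriv_of_isOpen hP.isOpen_regularSet).1 h1).2.2
    exact ((h2.differentiableOn one_ne_zero).differentiableAt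
      (hP.isOpen_regularSet.mem_nhds hx)).hasDerivAt
  set l := min (η / 3) 1 with hl
  have hl0 : 0 < l := lt_min (by positivity) one_pos
  have hl1 : l ≤ η / 3 := min_le_left _ _
  have hHolder : ∀ x y, x ≤ y → y - x ≤ l → (∀ t ∈ Icc x y, t ∈ regularSet F) →
      |deriv (deriv F) x - deriv (deriv F) y| ≤ |C| := by
    intro x y hxy hyl hreg
    rcases hxy.eq_or_lt with rfl | hlt
    · simp
    · refine (hh x y hlt hreg).trans ?_
      have h1 : (y - x) ^ α ≤ 1 := Real.rpow_le_one (by linarith)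
        (hyl.trans (min_le_right _ _)) hα.le
      have h0 : 0 ≤ (y - x) ^ α := Real.rpow_nonneg (by linarith) _
      exact (mul_le_mul_of_nonneg_right (le_abs_self C) h0).trans
        (mul_le_of_le_one_right (abs_nonneg _) h1)
  have hwin : ∀ u v, v - u = l → (∀ t ∈ Icc u v, t ∈ regularSet F) →
      ∃ ξ ∈ Icc u v, |deriv (deriv F) ξ| ≤ 2 * c₂ / l := by
    intro u v huv hreg
    obtain ⟨ξ, h1, h2⟩ := exists_deriv_slope (g := deriv F) (show u < v by linarith)
      (fun t ht => (hd2 t (hreg t ht)).continuousAt.continuousWithinAt)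
      (fun t ht => (hd2 t (hreg t (Ioo_subset_Icc_self ht))).differentiableAt.differentiableWithinAt)
    refine ⟨ξ, Ioo_subset_Icc_self h1, ?_⟩
    have hu := hb u
    have hv := hb v
    rw [rightDeriv_eq_deriv (hreg u (left_mem_Icc.2 (by linarith)))] at hu
    rw [rightDeriv_eq_deriv (hreg v (right_mem_Icc.2 (by linarith)))] at hv
    rw [huv] at h2
    have h3 : |deriv (deriv F) ξ| * l = |deriv F v - deriv F u| := by
      rw [h2, abs_mul, abs_of_pos hl0]
    rw [le_div_iff₀ hl0, h3, abs_le]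
    constructor <;> linarith [hu.2.1, hu.2.2, hv.2.1, hv.2.2]
  have hbound : ∀ x ∈ regularSet F, |deriv (deriv F) x| ≤ 2 * c₂ / l + |C| := by
    intro x hx
    -- Break points are at least `η > 2 l` apart, so one of the two windows at `x` contains none.
    have hcase : (∀ t ∈ Icc x (x + l), t ∈ regularSet F) ∨
        (∀ t ∈ Icc (x - l) x, t ∈ regularSet F) := by
      by_contra! hcon
      obtain ⟨⟨t, ht, ht'⟩, s, hs, hs'⟩ := hcon
      have h1 : x ≠ t := by rintro rfl; exact ht' hx
      have h2 : x < t := lt_of_le_of_ne ht.1 h1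
      have := hgap s t (hs.2.trans_lt h2) hs' ht'
      linarith [ht.2, hs.1]
    rcases hcase with h | h
    · obtain ⟨ξ, h1, h2⟩ := hwin x (x + l) (by ring) h
      have h3 := hHolder x ξ h1.1 (by linarith [h1.2])
        (fun t ht => h t ⟨ht.1, ht.2.trans h1.2⟩)
      have := abs_sub_abs_le_abs_sub (deriv (deriv F) x) (deriv (deriv F) ξ)
      linarith
    · obtain ⟨ξ, h1, h2⟩ := hwin (x - l) x (by ring) h
      have h3 := hHolder ξ x h1.2 (by linarith [h1.1])
        (fun t ht => h t ⟨h1.1.trans ht.1, ht.2⟩)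
      rw [abs_sub_comm] at h3
      have := abs_sub_abs_le_abs_sub (deriv (deriv F) x) (deriv (deriv F) ξ)
      linarith
  have hc₂ : 0 < c₂ := by linarith [(hb 0).2.2, (hb 0).2.1]
  refine ⟨c₁, c₂, 2 * c₂ / l + |C|, α, η, hc, by positivity, hα, hα1, hη,
    fun x => (hb x).2.1.le, fun x => (hb x).1.1.le, fun x => (hb x).2.2.le, hd2, hbound,
    fun x y hxy hreg => (hh x y hxy hreg).trans ?_, hgap⟩
  have : 0 ≤ (y - x) ^ α := Real.rpow_nonneg (by linarith) _
  have h4 := le_abs_self C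
  have h5 : 0 ≤ 2 * c₂ / l := by positivity
  gcongr
  linarith

variable {c c' C α η : ℝ}

theorem SmoothBounds.slope_bounds (hP : IsPHomeo F) (hS : SmoothBounds F c c' C α η) {u v : ℝ}
    (huv : u < v) : c ≤ (F v - F u) / (v - u) ∧ (F v - F u) / (v - u) ≤ c' :=
  ⟨(le_div_iff₀ (sub_pos.2 huv)).2 (hP.le_sub_of_le_rightDeriv huv.le fun t _ => hS.le_right t),
    (div_le_iff₀ (sub_pos.2 huv)).2 (hP.sub_le_of_rightDeriv_le huv.le fun t _ => hS.right_le t)⟩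

theorem distortion_eq_slopes (z : Fin 4 → ℝ) (g : ℝ → ℝ) :
    distortion z g =
      (((g (z 1) - g (z 0)) / (z 1 - z 0)) * ((g (z 3) - g (z 2)) / (z 3 - z 2))) /
      (((g (z 2) - g (z 0)) / (z 2 - z 0)) * ((g (z 3) - g (z 1)) / (z 3 - z 1))) := by
  simp only [distortion, crossRatio]
  rw [div_mul_div_comm, div_mul_div_comm, div_div_div_comm]

/-- Subtract the quadratic Taylor polynomial at `a`, whose chord slopes are exactly affine in the
midpoint; two applications of the mean value theorem and the Hölder condition bound the rest. -/
theorem SmoothBounds.abs_slope_sub_le (hS : SmoothBounds F c c' C α η) {a b u v : ℝ}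
    (hreg : ∀ t ∈ Icc a b, t ∈ regularSet F) (hau : a ≤ u) (huv : u < v) (hvb : v ≤ b) :
    |(F v - F u) / (v - u) - (deriv F a + deriv (deriv F) a * ((u + v) / 2 - a))|
      ≤ C * (b - a) ^ (1 + α) := by
  have hab : a < b := hau.trans_lt (huv.trans_le hvb)
  have hL := sub_pos.2 hab
  set g : ℝ → ℝ := fun t => F t - (deriv F a * t + deriv (deriv F) a * (t - a) ^ 2 / 2) with hg
  have hgd : ∀ t ∈ Icc a b, HasDerivAt g (deriv F t - (deriv F a + deriv (deriv F) a * (t - a))) t := by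
    intro t ht
    have h1 := (differentiableAt_of_mem_regularSet (hreg t ht)).hasDerivAt
    have h2 : HasDerivAt (fun t : ℝ => deriv F a * t + deriv (deriv F) a * (t - a) ^ 2 / 2)
        (deriv F a + deriv (deriv F) a * (t - a)) t := by
      have h3 := ((hasDerivAt_id t).const_mul (deriv F a)).add
        (((((hasDerivAt_id t).sub_const a).pow 2).const_mul (deriv (deriv F) a)).div_const 2)
      refine h3.congr_deriv ?_
      simp
      ring
    exact h1.sub h2
  have hsub : ∀ t ∈ Icc u v, t ∈ Icc a b := fun t ht => ⟨hau.trans ht.1, ht.2.trans hvb⟩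
  obtain ⟨ξ, hξ, hξ'⟩ := exists_deriv_slope (g := g) huv
    (fun t ht => (hgd t (hsub t ht)).continuousAt.continuousWithinAt)
    (fun t ht => (hgd t (hsub t (Ioo_subset_Icc_self ht))).differentiableAt.differentiableWithinAt)
  have hξm := hsub ξ (Ioo_subset_Icc_self hξ)
  rw [(hgd ξ hξm).deriv] at hξ'
  have hvu := (sub_pos.2 huv).ne'
  have heq : (F v - F u) / (v - u) - (deriv F a + deriv (deriv F) a * ((u + v) / 2 - a)) =
      deriv F ξ - (deriv F a + deriv (deriv F) a * (ξ - a)) := by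
    rw [div_sub' hvu, div_eq_iff hvu]
    simp only [hg] at hξ'
    linarith
  rw [heq]
  have haξ : a < ξ := hau.trans_lt hξ.1
  obtain ⟨ζ, hζ, hζ'⟩ := exists_deriv_slope (g := deriv F) haξ
    (fun t ht => (hS.hasDerivAt t (hreg t ⟨ht.1, ht.2.trans hξm.2⟩)).continuousAt.continuousWithinAt)
    (fun t ht => (hS.hasDerivAt t (hreg t ⟨ht.1.le, ht.2.le.trans
      hξm.2⟩)).differentiableAt.differentiableWithinAt)
  have h1 : deriv F ξ - (deriv F a + deriv (deriv F) a * (ξ - a)) =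
      -(deriv (deriv F) a - deriv (deriv F) ζ) * (ξ - a) := by linarith
  have h2 := hS.holder a ζ hζ.1 fun t ht => hreg t ⟨ht.1, ht.2.trans (hζ.2.le.trans hξm.2)⟩
  have h3 : (ζ - a) ^ α ≤ (b - a) ^ α :=
    Real.rpow_le_rpow (by linarith [hζ.1]) (by linarith [hζ.2, hξm.2]) hS.α_pos.le
  rw [h1, abs_mul, abs_neg, abs_of_pos (sub_pos.2 haξ), Real.rpow_add hL, Real.rpow_one]
  have hC := hS.C_nonneg
  have h4 : |deriv (deriv F) a - deriv (deriv F) ζ| ≤ C * (b - a) ^ α :=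
    h2.trans (by gcongr)
  have h5 : 0 ≤ C * (b - a) ^ α := (abs_nonneg _).trans h4
  calc |deriv (deriv F) a - deriv (deriv F) ζ| * (ξ - a) ≤ C * (b - a) ^ α * (b - a) :=
        mul_le_mul h4 (by linarith [hξm.2]) (by linarith) h5
    _ = C * ((b - a) * (b - a) ^ α) := by ring

theorem abs_mul_sub_mul_le {s s' p p' K E : ℝ} (hs : |s - p| ≤ E) (hs' : |s' - p'| ≤ E)
    (hp : |p| ≤ K) (hsK : |s'| ≤ K) : |s * s' - p * p'| ≤ 2 * K * E := by
  have h : s * s' - p * p' = (s - p) * s' + p * (s' - p') := by ring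
  rw [h]
  refine (abs_add_le _ _).trans ?_
  rw [abs_mul, abs_mul]
  have h6 := mul_le_mul hs hsK (abs_nonneg _) ((abs_nonneg _).trans hs)
  have h7 := mul_le_mul hp hs' (abs_nonneg _) ((abs_nonneg _).trans hp)
  linarith

/-- The distortion of cross-ratios on intervals without break points is of order `1 + α`. -/
theorem SmoothBounds.abs_log_distortion_le (hP : IsPHomeo F) (hS : SmoothBounds F c c' C α η)
    {z : Fin 4 → ℝ} (hz : CyclicLift z) (hreg : ∀ t ∈ Icc (z 0) (z 3), t ∈ regularSet F) :
    |Real.log (distortion z F)| ≤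
      (4 * (c' + C) * C + 2 * C * C) / (c * c) * (z 3 - z 0) ^ (1 + α) := by
  have hdist := distortion_eq_slopes z F
  have hlt := hz.lt
  obtain ⟨h1, h2, h3, h4⟩ := hz
  set L := z 3 - z 0 with hL
  have hL0 : 0 < L := sub_pos.2 hlt
  have hL1 : L ≤ 1 := by linarith
  set P := deriv F (z 0)
  set Q := deriv (deriv F) (z 0)
  set E := C * L ^ (1 + α) with hE
  have hc := hS.c_pos
  have hC := hS.C_nonneg
  have e1 := hS.abs_slope_sub_le hreg le_rfl h1 (h2.trans h3).le
  have e2 := hS.abs_slope_sub_le hreg (h1.trans h2).le h3 le_rfl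
  have e3 := hS.abs_slope_sub_le hreg le_rfl (h1.trans h2) h3.le
  have e4 := hS.abs_slope_sub_le hreg h1.le (h2.trans h3) le_rfl
  have b1 := hS.slope_bounds hP h1
  have b2 := hS.slope_bounds hP h3
  have b3 := hS.slope_bounds hP (h1.trans h2)
  have b4 := hS.slope_bounds hP (h2.trans h3)
  set s1 := (F (z 1) - F (z 0)) / (z 1 - z 0)
  set s2 := (F (z 3) - F (z 2)) / (z 3 - z 2)
  set s3 := (F (z 2) - F (z 0)) / (z 2 - z 0)
  set s4 := (F (z 3) - F (z 1)) / (z 3 - z 1)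
  set m1 := (z 0 + z 1) / 2 - z 0 with hm1
  set m2 := (z 2 + z 3) / 2 - z 0 with hm2
  set m3 := (z 0 + z 2) / 2 - z 0 with hm3
  set m4 := (z 1 + z 3) / 2 - z 0 with hm4
  have hP0 : |P| ≤ c' := by
    have hr := rightDeriv_eq_deriv (hreg (z 0) (left_mem_Icc.2 hlt.le))
    have h5 := hS.le_right (z 0)
    have h6 := hS.right_le (z 0)
    rw [hr] at h5 h6
    rw [abs_of_pos (hc.trans_le h5)]
    exact h6
  have hQ0 : |Q| ≤ C := hS.abs_le _ (hreg (z 0) (left_mem_Icc.2 hlt.le))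
  have hc' : 0 ≤ c' := (abs_nonneg _).trans hP0
  have hPQ : ∀ m, 0 ≤ m → m ≤ L → |P + Q * m| ≤ c' + C := by
    intro m hm hmL
    refine (abs_add_le _ _).trans (add_le_add hP0 ?_)
    rw [abs_mul, abs_of_nonneg hm]
    exact (mul_le_mul hQ0 (hmL.trans hL1) hm hC).trans (by rw [mul_one])
  have hslope : ∀ s, c ≤ s ∧ s ≤ c' → |s| ≤ c' + C := fun s hs => by
    rw [abs_of_pos (hc.trans_le hs.1)]
    linarith [hs.2]
  have q1 : 0 ≤ m1 ∧ m1 ≤ L := ⟨by linarith, by linarith⟩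
  have q2 : 0 ≤ m2 ∧ m2 ≤ L := ⟨by linarith, by linarith⟩
  have q3 : 0 ≤ m3 ∧ m3 ≤ L := ⟨by linarith, by linarith⟩
  have q4 : 0 ≤ m4 ∧ m4 ≤ L := ⟨by linarith, by linarith⟩
  -- Here `α ≤ 1` is needed: quadratic terms are absorbed into the error.
  have hLL : L * L ≤ L ^ (1 + α) := by
    rw [Real.rpow_add hL0, Real.rpow_one]
    have := Real.rpow_le_rpow_of_exponent_ge hL0 hL1 hS.α_le
    rw [Real.rpow_one] at this
    gcongr
  have hmid : |Q * Q * (m1 * m2 - m3 * m4)| ≤ 2 * C * C * L ^ (1 + α) := by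
    have h6 : |m1 * m2 - m3 * m4| ≤ 2 * (L * L) := by
      have r1 : m1 * m2 ≤ L * L := mul_le_mul q1.2 q2.2 q2.1 hL0.le
      have r2 : m3 * m4 ≤ L * L := mul_le_mul q3.2 q4.2 q4.1 hL0.le
      have r3 := mul_nonneg q1.1 q2.1
      have r4 := mul_nonneg q3.1 q4.1
      have r5 := mul_pos hL0 hL0
      rw [_root_.abs_le]
      constructor <;> linarith
    rw [abs_mul, abs_mul]
    calc |Q| * |Q| * |m1 * m2 - m3 * m4| ≤ C * C * (2 * (L * L)) := by gcongr
      _ ≤ C * C * (2 * L ^ (1 + α)) := by gcongr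
      _ = 2 * C * C * L ^ (1 + α) := by ring
  have hdiff : |s1 * s2 - s3 * s4| ≤ (4 * (c' + C) * C + 2 * C * C) * L ^ (1 + α) := by
    have p1 : |s1 * s2 - (P + Q * m1) * (P + Q * m2)| ≤ 2 * (c' + C) * E :=
      abs_mul_sub_mul_le e1 e2 (hPQ m1 q1.1 q1.2) (hslope s2 b2)
    have p2 : |s3 * s4 - (P + Q * m3) * (P + Q * m4)| ≤ 2 * (c' + C) * E :=
      abs_mul_sub_mul_le e3 e4 (hPQ m3 q3.1 q3.2) (hslope s4 b4)
    have h5 : s1 * s2 - s3 * s4 = (s1 * s2 - (P + Q * m1) * (P + Q * m2)) +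
      Q * Q * (m1 * m2 - m3 * m4) - (s3 * s4 - (P + Q * m3) * (P + Q * m4)) := by
      -- The cancellation behind the exponent `1 + α`: both pairs of chords have the same sum of
      -- midpoints.
      have : m1 + m2 = m3 + m4 := by rw [hm1, hm2, hm3, hm4]; ring
      linear_combination (-P * Q) * this
    rw [h5]
    refine (abs_sub _ _).trans ((add_le_add (abs_add_le _ _) le_rfl).trans ?_)
    rw [hE] at p1 p2
    linarith
  have g1 : c * c ≤ s1 * s2 := mul_le_mul b1.1 b2.1 hc.le (hc.le.trans b1.1)
  have g2 : c * c ≤ s3 * s4 := mul_le_mul b3.1 b4.1 hc.le (hc.le.trans b3.1)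
  have hcc : 0 < c * c := mul_pos hc hc
  rw [hdist, Real.log_div (hcc.trans_le g1).ne' (hcc.trans_le g2).ne']
  refine (abs_log_sub_log_le hcc g1 g2).trans ?_
  rw [div_mul_eq_mul_div (4 * (c' + C) * C + 2 * C * C)]
  exact div_le_div_of_nonneg_right hdiff hcc.le

/-- Only the open interval must be free of break points, so shrinking a chord towards an end point
yields comparison with a one-sided derivative at a break. -/
theorem SmoothBounds.abs_slope_sub_slope_le (hP : IsPHomeo F) (hS : SmoothBounds F c c' C α η)
    {a b u v u' v' : ℝ} (hreg : ∀ t ∈ Ioo a b, t ∈ regularSet F) (hau : a ≤ u) (huv : u < v)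
    (hvb : v ≤ b) (hau' : a ≤ u') (huv' : u' < v') (hvb' : v' ≤ b) :
    |(F v - F u) / (v - u) - (F v' - F u') / (v' - u')| ≤ C * (b - a) := by
  have hex : ∀ u v, a ≤ u → u < v → v ≤ b →
      ∃ ξ ∈ Ioo a b, (F v - F u) / (v - u) = deriv F ξ := by
    intro u v hau huv hvb
    obtain ⟨ξ, h1, h2⟩ := exists_deriv_slope huv hP.continuous.continuousOn
      (fun t ht => (differentiableAt_of_mem_regularSet
        (hreg t ⟨hau.trans_lt ht.1, ht.2.trans_le hvb⟩)).differentiableWithinAt)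
    exact ⟨ξ, ⟨hau.trans_lt h1.1, h1.2.trans_le hvb⟩, by
      rw [h2, mul_div_cancel_right₀ _ (sub_pos.2 huv).ne']⟩
  have hlip : ∀ x ∈ Ioo a b, ∀ y ∈ Ioo a b, x < y → |deriv F x - deriv F y| ≤ C * (b - a) := by
    intro x hx y hy hxy
    obtain ⟨ξ, h1, h2⟩ := exists_deriv_slope (g := deriv F) hxy
      (fun t ht => (hS.hasDerivAt t (hreg t ⟨hx.1.trans_le ht.1,
        ht.2.trans_lt hy.2⟩)).continuousAt.continuousWithinAt)
      (fun t ht => (hS.hasDerivAt t (hreg t ⟨hx.1.trans ht.1,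
        ht.2.trans hy.2⟩)).differentiableAt.differentiableWithinAt)
    rw [abs_sub_comm, h2, abs_mul, abs_of_pos (sub_pos.2 hxy)]
    exact mul_le_mul (hS.abs_le ξ (hreg ξ ⟨hx.1.trans h1.1, h1.2.trans hy.2⟩))
      (by linarith [hx.1, hy.2]) (by linarith) hS.C_nonneg
  obtain ⟨x, hx, hx'⟩ := hex u v hau huv hvb
  obtain ⟨y, hy, hy'⟩ := hex u' v' hau' huv' hvb'
  rw [hx', hy']
  rcases lt_trichotomy x y with h | rfl | h
  · exact hlip x hx y hy h
  · rw [sub_self, abs_zero]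
    exact mul_nonneg hS.C_nonneg (by linarith [hx.1, hx.2])
  · rw [abs_sub_comm]
    exact hlip y hy x hx h

theorem SmoothBounds.abs_slope_sub_rightDeriv_le (hP : IsPHomeo F)
    (hS : SmoothBounds F c c' C α η) {a b u v : ℝ} (hreg : ∀ t ∈ Ioo a b, t ∈ regularSet F)
    (hau : a ≤ u) (huv : u < v) (hvb : v ≤ b) :
    |(F v - F u) / (v - u) - rightDeriv F a| ≤ C * (b - a) := by
  have hab : a < b := hau.trans_lt (huv.trans_le hvb)
  have h1 := (hP.hasDerivWithinAt_right a).Ioi_of_Ici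
  rw [hasDerivWithinAt_iff_tendsto_slope' (by simp)] at h1
  refine le_of_tendsto ((tendsto_const_nhds.sub h1).abs) ?_
  filter_upwards [Ioo_mem_nhdsGT hab] with w hw
  rw [slope_def_field]
  exact hS.abs_slope_sub_slope_le hP hreg hau huv hvb le_rfl hw.1 hw.2.le

theorem SmoothBounds.abs_slope_sub_leftDeriv_le (hP : IsPHomeo F)
    (hS : SmoothBounds F c c' C α η) {a b u v : ℝ} (hreg : ∀ t ∈ Ioo a b, t ∈ regularSet F)
    (hau : a ≤ u) (huv : u < v) (hvb : v ≤ b) :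
    |(F v - F u) / (v - u) - leftDeriv F b| ≤ C * (b - a) := by
  have hab : a < b := hau.trans_lt (huv.trans_le hvb)
  have h1 := (hP.hasDerivWithinAt_left b).Iio_of_Iic
  rw [hasDerivWithinAt_iff_tendsto_slope' (by simp)] at h1
  refine le_of_tendsto ((tendsto_const_nhds.sub h1).abs) ?_
  filter_upwards [Ioo_mem_nhdsLT hab] with w hw
  rw [slope_comm, slope_def_field]
  exact hS.abs_slope_sub_slope_le hP hreg hau huv hvb hw.1.le hw.2 le_rfl

/-- The relation `e^{-d} x ≤ y ≤ e^d x`. -/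
def ExpClose (d x y : ℝ) : Prop := Real.exp (-d) * x ≤ y ∧ y ≤ Real.exp d * x

/-- The increment over a chord crossing the break is a sum of a left and a right piece;
multiplicative closeness survives this sum. -/
theorem ExpClose.add {d x y x' y' : ℝ} (h : ExpClose d x y) (h' : ExpClose d x' y') :
    ExpClose d (x + x') (y + y') :=
  ⟨by rw [mul_add]; exact add_le_add h.1 h'.1, by rw [mul_add]; exact add_le_add h.2 h'.2⟩

theorem ExpClose.abs_log_sub_le {d x y : ℝ} (hx : 0 < x) (h : ExpClose d x y) :
    |Real.log y - Real.log x| ≤ d := by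
  have hy : 0 < y := (mul_pos (Real.exp_pos _) hx).trans_le h.1
  have h1 := Real.log_le_log (mul_pos (Real.exp_pos _) hx) h.1
  have h2 := Real.log_le_log hy h.2
  rw [Real.log_mul (Real.exp_pos _).ne' hx.ne', Real.log_exp] at h1 h2
  rw [abs_le]
  constructor <;> linarith

/-- The case `p = 0` is kept because the break may be an end point of the chord. -/
theorem expClose_of_abs_slope_sub_le {d D p q m : ℝ} (hm : 0 < m) (hD : m ≤ D) (hp : 0 ≤ p)
    (hq : 0 < p → m ≤ q / p) (hq0 : p = 0 → q = 0) (h : 0 < p → |q / p - D| ≤ d * m) :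
    ExpClose d (D * p) q := by
  rcases hp.eq_or_lt with h0 | h0
  · rw [hq0 h0.symm, ← h0, mul_zero]
    exact ⟨by simp, by simp⟩
  · have h1 := (abs_log_sub_log_le hm (hq h0) hD).trans
      (div_le_div_of_nonneg_right (h h0) hm.le)
    rw [mul_div_cancel_right₀ _ hm.ne', abs_le] at h1
    have hqp := hm.trans_le (hq h0)
    have hD0 := hm.trans_le hD
    have e1 : Real.log D + -d ≤ Real.log (q / p) := by linarith
    have e2 : Real.log (q / p) ≤ Real.log D + d := by linarith
    rw [← Real.exp_le_exp, Real.exp_add, Real.exp_log hqp, Real.exp_log hD0] at e1 e2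
    rw [le_div_iff₀ h0] at e1
    rw [div_le_iff₀ h0] at e2
    exact ⟨by linarith, by linarith⟩

/-- The distortion of cross-ratios on a short interval with a break point in its first part. -/
theorem SmoothBounds.abs_log_distortion_sub_log_jumpFun_le (hP : IsPHomeo F)
    (hS : SmoothBounds F c c' C α η) {z : Fin 4 → ℝ} (hz : CyclicLift z) {t : ℝ}
    (ht : t ∈ Icc (z 0) (z 1)) (htb : (t : UnitAddCircle) ∈ breakSet F) (hη : z 3 - z 0 < η) :
    |Real.log (distortion z F) - Real.log (jumpFun (jump F t) ((z 2 - z 1) / (z 1 - z 0))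
      ((z 1 - t) / (z 1 - z 0)))| ≤ 4 * (C / c) * (z 3 - z 0) := by
  obtain ⟨h1, h2, h3, h4⟩ := hz
  have hc := hS.c_pos
  have hC := hS.C_nonneg
  set L := z 3 - z 0 with hL
  set d := C / c * L with hd
  have htn : t ∉ regularSet F := fun h => h htb
  -- The arc is shorter than the gap `η`, so `t` is its only break.
  have hreg : ∀ s ∈ Icc (z 0) (z 3), s ≠ t → s ∈ regularSet F := by
    intro s hs hst
    by_contra hsn
    rcases lt_or_gt_of_ne hst with h | h
    · have := hS.gap s t h hsn htn
      linarith [hs.1, ht.2]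
    · have := hS.gap t s h htn hsn
      linarith [hs.2, ht.1]
  have hdc : d * c = C * L := by rw [hd]; field_simp
  have hright : ∀ u v, t ≤ u → u ≤ v → v ≤ z 3 →
      ExpClose d (rightDeriv F t * (v - u)) (F v - F u) := by
    intro u v htu huv hv
    refine expClose_of_abs_slope_sub_le hc (hS.le_right t) (sub_nonneg.2 huv)
      (fun h => (hS.slope_bounds hP (sub_pos.1 h)).1) (fun h => ?_) (fun h => ?_)
    · rw [sub_eq_zero] at h
      rw [h, sub_self]
    · rw [hdc]
      refine (hS.abs_slope_sub_rightDeriv_le hP (a := t) (b := z 3) (fun s hs => hreg s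
        ⟨ht.1.trans hs.1.le, hs.2.le⟩ hs.1.ne') htu (sub_pos.1 h) hv).trans ?_
      exact mul_le_mul_of_nonneg_left (by linarith [ht.1]) hC
  have hleft : ExpClose d (leftDeriv F t * (t - z 0)) (F t - F (z 0)) := by
    refine expClose_of_abs_slope_sub_le hc (hS.le_left t) (sub_nonneg.2 ht.1)
      (fun h => (hS.slope_bounds hP (sub_pos.1 h)).1) (fun h => ?_) (fun h => ?_)
    · rw [sub_eq_zero] at h
      rw [h, sub_self]
    · rw [hdc]
      refine (hS.abs_slope_sub_leftDeriv_le hP (a := z 0) (b := t) (fun s hs => hreg s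
        ⟨hs.1.le, by linarith [hs.2, ht.2]⟩ hs.2.ne) le_rfl (sub_pos.1 h) le_rfl).trans ?_
      exact mul_le_mul_of_nonneg_left (by linarith [ht.2]) hC
  have hA := hleft.add (hright t (z 1) le_rfl ht.2 (h2.trans h3).le)
  have hB := hleft.add (hright t (z 2) le_rfl (ht.2.trans h2.le) h3.le)
  have hX := hright (z 2) (z 3) (ht.2.trans h2.le) h3.le le_rfl
  have hY := hright (z 1) (z 3) ht.2 (h2.trans h3).le le_rfl
  rw [show F t - F (z 0) + (F (z 1) - F t) = F (z 1) - F (z 0) by ring] at hA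
  rw [show F t - F (z 0) + (F (z 2) - F t) = F (z 2) - F (z 0) by ring] at hB
  have hσ := hP.jump_coe t
  set σ := jump F t
  set Dl := leftDeriv F t
  set Dr := rightDeriv F t
  have hDr : 0 < Dr := hP.rightDeriv_pos t
  have hDl : 0 < Dl := hP.leftDeriv_pos t
  have a0 : 0 < z 1 - z 0 := sub_pos.2 h1
  have t0 : 0 ≤ t - z 0 := sub_nonneg.2 ht.1
  have t1 : 0 ≤ z 1 - t := sub_nonneg.2 ht.2
  have pA : 0 < Dl * (t - z 0) + Dr * (z 1 - t) := by
    rcases t0.eq_or_lt with h | h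
    · have : 0 < z 1 - t := by linarith
      rw [← h]; positivity
    · positivity
  have pB : 0 < Dl * (t - z 0) + Dr * (z 2 - t) := by
    have := mul_lt_mul_of_pos_left (show z 1 - t < z 2 - t by linarith) hDr
    linarith
  have pX : 0 < Dr * (z 3 - z 2) := mul_pos hDr (sub_pos.2 h3)
  have pY : 0 < Dr * (z 3 - z 1) := mul_pos hDr (sub_pos.2 (h2.trans h3))
  have lA := hA.abs_log_sub_le pA
  have lB := hB.abs_log_sub_le pB
  have lX := hX.abs_log_sub_le pX
  have lY := hY.abs_log_sub_le pY
  have b0 : 0 < z 3 - z 2 := sub_pos.2 h3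
  have b1 : 0 < z 2 - z 0 := sub_pos.2 (h1.trans h2)
  have b2 : 0 < z 3 - z 1 := sub_pos.2 (h2.trans h3)
  have f1 := sub_pos.2 (hP.strictMono h1)
  have f2 := sub_pos.2 (hP.strictMono h3)
  have f3 := sub_pos.2 (hP.strictMono (h1.trans h2))
  have f4 := sub_pos.2 (hP.strictMono (h2.trans h3))
  -- `jumpFun` is the exact distortion under the broken line with slopes `Dl`, `Dr` at `t`. Each of
  -- the four increments of `F` has logarithm within `d` of its broken-line value, whence the factor
  -- `4`.
  have hG : jumpFun σ ((z 2 - z 1) / (z 1 - z 0)) ((z 1 - t) / (z 1 - z 0)) =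
      (((Dl * (t - z 0) + Dr * (z 1 - t)) * (Dr * (z 3 - z 2))) /
        ((Dl * (t - z 0) + Dr * (z 2 - t)) * (Dr * (z 3 - z 1)))) /
      (((z 1 - z 0) * (z 3 - z 2)) / ((z 2 - z 0) * (z 3 - z 1))) := by
    have hnum : σ + (1 - σ) * ((z 1 - t) / (z 1 - z 0)) =
        (Dl * (t - z 0) + Dr * (z 1 - t)) / (Dr * (z 1 - z 0)) := by
      rw [hσ]; field_simp; ring
    have hden : σ + (1 - σ) * ((z 1 - t) / (z 1 - z 0)) + (z 2 - z 1) / (z 1 - z 0) =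
        (Dl * (t - z 0) + Dr * (z 2 - t)) / (Dr * (z 1 - z 0)) := by
      rw [hnum]; field_simp; ring
    have hone : 1 + (z 2 - z 1) / (z 1 - z 0) = (z 2 - z 0) / (z 1 - z 0) := by
      field_simp; ring
    rw [jumpFun, hden, hnum, hone]
    field_simp
  have hcr : 0 < ((z 1 - z 0) * (z 3 - z 2)) / ((z 2 - z 0) * (z 3 - z 1)) := by positivity
  have hlog : ∀ p q r s u : ℝ, 0 < p → 0 < q → 0 < r → 0 < s → 0 < u →
      Real.log (p * q / (r * s) / u) =
        Real.log p + Real.log q - (Real.log r + Real.log s) - Real.log u := by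
    intro p q r s u hp hq hr hs hu
    rw [Real.log_div (by positivity) hu.ne', Real.log_div (by positivity) (by positivity),
      Real.log_mul hp.ne' hq.ne', Real.log_mul hr.ne' hs.ne']
  rw [hG, distortion, crossRatio, crossRatio, hlog _ _ _ _ _ f1 f2 f3 f4 hcr,
    hlog _ _ _ _ _ pA pX pB pY hcr]
  rw [_root_.abs_le] at lA lB lX lY ⊢
  constructor <;> linarith

end

/-! ### Distortion of long iterates. -/

section

variable {F : CircleDeg1Lift}

theorem crossRatio_pos {z : Fin 4 → ℝ} (h1 : z 0 < z 1) (h2 : z 1 < z 2) (h3 : z 2 < z 3) :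
    0 < crossRatio z :=
  div_pos (mul_pos (sub_pos.2 h1) (sub_pos.2 h3))
    (mul_pos (sub_pos.2 (h1.trans h2)) (sub_pos.2 (h2.trans h3)))

theorem CyclicLift.crossRatio_pos {z : Fin 4 → ℝ} (hz : CyclicLift z) : 0 < crossRatio z :=
  BreakCircle.crossRatio_pos hz.1 hz.2.1 hz.2.2.1

theorem distortion_iterate_pos (hF : StrictMono F) {z : Fin 4 → ℝ} (hz : CyclicLift z) (r : ℕ) :
    0 < distortion z F^[r] :=
  div_pos (hz.iterate hF r).crossRatio_pos hz.crossRatio_pos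

/-- The distortion of an iterate is the product of the distortions along the orbit. -/
theorem log_distortion_iterate (hF : StrictMono F) {z : Fin 4 → ℝ} (hz : CyclicLift z) (r : ℕ) :
    Real.log (distortion z F^[r]) =
      ∑ j ∈ Finset.range r, Real.log (distortion (fun i => F^[j] (z i)) F) := by
  have h : ∀ j, Real.log (distortion (fun i => F^[j] (z i)) F) =
      Real.log (crossRatio fun i => F^[j + 1] (z i)) - Real.log (crossRatio fun i => F^[j] (z i)) := by
    intro j
    rw [distortion]
    simp only [← Function.iterate_succ_apply' F]
    exact Real.log_div (hz.iterate hF (j + 1)).crossRatio_pos.ne'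
      (hz.iterate hF j).crossRatio_pos.ne'
  rw [Finset.sum_congr rfl fun j _ => h j,
    Finset.sum_range_sub (fun j => Real.log (crossRatio fun i => F^[j] (z i))), distortion,
    Real.log_div (hz.iterate hF r).crossRatio_pos.ne' hz.crossRatio_pos.ne']
  simp

theorem jumpFun_pos {s x y : ℝ} (hs : 0 < s) (hx : 0 < x) (hy : 0 ≤ y) (hy1 : y < 1) :
    0 < jumpFun s x y := by
  have h : 0 < s + (1 - s) * y := by
    have : s + (1 - s) * y = s * (1 - y) + y := by ring
    rw [this]
    have := mul_pos hs (sub_pos.2 hy1)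
    linarith
  exact div_pos (mul_pos h (by linarith)) (by linarith)

/-- A break point covered by the arcs is the image of a point of the initial interval. -/
theorem exists_preimage_of_mem_iterArc (hP : IsPHomeo F) {z : Fin 4 → ℝ} {j : ℕ}
    {b : UnitAddCircle} (h : b ∈ iterArc F z j) :
    ∃ t ∈ Icc (z 0) (z 3), ((F^[j] t : ℝ) : UnitAddCircle) = b := by
  obtain ⟨s, hs, rfl⟩ := h
  obtain ⟨t, rfl⟩ := (hP.bijective.iterate j).2 s
  have hm := hP.strictMono.iterate j
  exact ⟨t, ⟨hm.le_iff_le.1 hs.1, hm.le_iff_le.1 hs.2⟩, rfl⟩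

theorem exists_pos_rpow_add_lt (k₁ k₂ : ℝ) {α η ε : ℝ} (hα : 0 < α) (hη : 0 < η) (hε : 0 < ε) :
    ∃ e > 0, e < η ∧ k₁ * e ^ α + k₂ * e < ε := by
  have h1 : Tendsto (fun e : ℝ => k₁ * e ^ α + k₂ * e) (𝓝[>] 0) (𝓝 0) := by
    have hc : Continuous fun e : ℝ => k₁ * e ^ α + k₂ * e := by
      have := Real.continuous_rpow_const hα.le
      fun_prop
    have := hc.tendsto 0
    simp only [Real.zero_rpow hα.ne', mul_zero, add_zero] at this
    exact this.mono_left nhdsWithin_le_nhds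
  obtain ⟨e, he, h2, h3⟩ := (eventually_mem_nhdsWithin.and
    ((h1.eventually (gt_mem_nhds hε)).and
      (mem_nhdsWithin_of_mem_nhds (gt_mem_nhds hη)))).exists
  exact ⟨e, he, h3, h2⟩

/-- The distortion of long iterates on small regularly covering triples is given by the jumps. -/
theorem IsPHomeo.exists_log_distortion_close (hP : IsPHomeo F)
    (hirr : Irrational F.translationNumber) (hC : IsPiecewiseC2Holder F) {Ω θ ε : ℝ}
    (hΩ : 0 < Ω) (hθ : 0 < θ) (hθ1 : θ ≤ 1) (hε : 0 < ε) :
    ∃ R : ℕ, ∀ r ≥ R, ∀ z : Fin 4 → ℝ, CyclicLift z → IsSmall F r z → ∀ K M δ ζ x₀ : ℝ,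
      ((coveredBreaks F r z).Nonempty →
        RegularCover F (coveredBreaks F r z) K M δ ζ x₀ r z) →
      Ω * Real.exp (logVar F).toReal ≤ M → ζ * Real.exp (logVar F).toReal ≤ θ →
      ∃ x y : UnitAddCircle → ℝ,
        (∀ b ∈ coveredBreaks F r z, Ω ≤ x b ∧ 0 ≤ y b ∧ y b < θ) ∧
        0 < (∏ᶠ b ∈ coveredBreaks F r z, jumpFun (jump F b) (x b) (y b)) ∧
        |Real.log (distortion z F^[r]) -
          Real.log (∏ᶠ b ∈ coveredBreaks F r z, jumpFun (jump F b) (x b) (y b))| ≤ ε := by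
  classical
  obtain ⟨c, c', C, α, η, hS⟩ := hP.exists_smoothBounds hC
  obtain ⟨W, hW⟩ := hP.exists_isMajorant
  set V := (logVar F).toReal
  have hc := hS.c_pos
  have hC0 := hS.C_nonneg
  have hc' : 0 < c' := hc.trans_le ((hS.le_right 0).trans (hS.right_le 0))
  set k₁ := (4 * (c' + C) * C + 2 * C * C) / (c * c) with hk₁
  set k₂ := 4 * (C / c) with hk₂
  have hk₁0 : 0 ≤ k₁ := by positivity
  have hk₂0 : 0 ≤ k₂ := by positivity
  -- `e` will bound all arc lengths; the two terms are the total errors of the arcs without and with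
  -- break points.
  obtain ⟨e, he, heη, heε⟩ := exists_pos_rpow_add_lt k₁ (hP.finite_breaks.toFinset.card * k₂)
    hS.α_pos hS.η_pos hε
  obtain ⟨R, hR⟩ := hP.exists_iterate_sub_lt hirr he
  refine ⟨R, fun r hr z hz hs K M δ ζ x₀ hreg hM hζ => ?_⟩
  have hlen := hR r hr z hz hs
  set B := coveredBreaks F r z with hB
  have hfin : B.Finite := hP.finite_breaks.subset fun b hb => hb.1
  have hm := fun i : ℕ => hP.strictMono.iterate i
  have hex : ∀ b, ∃ l : ℕ, ∃ t : ℝ, b ∈ B → l < r ∧ b ∈ iterArc F z l ∧ t ∈ Icc (z 0) (z 3) ∧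
      ((F^[l] t : ℝ) : UnitAddCircle) = b := by
    intro b
    by_cases hb : b ∈ B
    · obtain ⟨l, hl, hbl⟩ := hb.2
      obtain ⟨t, ht, htb⟩ := exists_preimage_of_mem_iterArc hP hbl
      exact ⟨l, t, fun _ => ⟨hl, hbl, ht, htb⟩⟩
    · exact ⟨0, 0, fun h => absurd h hb⟩
  choose l t hlt using hex
  have ht1 : ∀ b ∈ B, t b ∈ Icc (z 0) (z 1) := fun b hb =>
    (hreg ⟨b, hb⟩).preimage_mem b hb (l b) (hlt b hb).1 (t b) (hlt b hb).2.2.1 (hlt b hb).2.2.2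
  set x : UnitAddCircle → ℝ := fun b =>
    (F^[l b] (z 2) - F^[l b] (z 1)) / (F^[l b] (z 1) - F^[l b] (z 0)) with hx
  set y : UnitAddCircle → ℝ := fun b =>
    (F^[l b] (z 1) - F^[l b] (t b)) / (F^[l b] (z 1) - F^[l b] (z 0)) with hy
  -- Passing from time `0` to time `l b` changes length ratios by at most `e^V`, which the bounds on
  -- `M` and `ζ` absorb.
  have hxy : ∀ b ∈ B, Ω ≤ x b ∧ 0 ≤ y b ∧ y b < θ := by
    intro b hb
    have hrc := hreg ⟨b, hb⟩
    have p1 := hP.iterate_sub_pos (l b) hz.1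
    have p2 := hP.iterate_sub_pos (l b) hz.2.1
    have d1 := sub_pos.2 hz.1
    have d2 := sub_pos.2 hz.2.1
    refine ⟨?_, div_nonneg (sub_nonneg.2 ((hm _).monotone (ht1 b hb).2)) p1.le, ?_⟩
    · have h1 := hW.div_iterate_le hP hz hs (hlt b hb).1.le le_rfl hz.1
        (hz.2.1.trans hz.2.2.1).le hz.1.le hz.2.1 hz.2.2.1.le
      rw [← mul_div_assoc, div_le_div_iff₀ p2 d2] at h1
      have h2 : Ω * Real.exp V * (z 1 - z 0) ≤ z 2 - z 1 :=
        (mul_le_mul_of_nonneg_right hM d1.le).trans hrc.lower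
      simp only [hx]
      rw [le_div_iff₀ p1]
      refine le_of_mul_le_mul_right ?_ d2
      calc Ω * (F^[l b] (z 1) - F^[l b] (z 0)) * (z 2 - z 1)
          = Ω * ((F^[l b] (z 1) - F^[l b] (z 0)) * (z 2 - z 1)) := by ring
        _ ≤ Ω * (Real.exp V * (z 1 - z 0) * (F^[l b] (z 2) - F^[l b] (z 1))) := by gcongr
        _ = (Ω * Real.exp V * (z 1 - z 0)) * (F^[l b] (z 2) - F^[l b] (z 1)) := by ring
        _ ≤ (z 2 - z 1) * (F^[l b] (z 2) - F^[l b] (z 1)) := by gcongr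
        _ = _ := by ring
    · rcases (ht1 b hb).2.eq_or_lt with h | h
      · simp only [hy, h, sub_self, zero_div]
        exact hθ
      · have h1 := hW.div_iterate_le hP hz hs (hlt b hb).1.le (ht1 b hb).1 h
          (hz.2.1.trans hz.2.2.1).le le_rfl hz.1 (hz.2.1.trans hz.2.2.1).le
        have h2 := hrc.preimage_close b hb (l b) (hlt b hb).1 (t b) (hlt b hb).2.2.1
          (hlt b hb).2.2.2
        have h3 := mul_lt_mul_of_pos_left h2 (Real.exp_pos V)
        simp only [hy]
        linarith
  have hG : ∀ b ∈ B, 0 < jumpFun (jump F b) (x b) (y b) := fun b hb =>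
    jumpFun_pos (hP.jump_pos b) (hΩ.trans_le (hxy b hb).1) (hxy b hb).2.1
      ((hxy b hb).2.2.trans_le hθ1)
  refine ⟨x, y, hxy, ?_⟩
  rw [finprod_mem_eq_finite_toFinset_prod _ hfin]
  refine ⟨Finset.prod_pos fun b hb => hG b (hfin.mem_toFinset.1 hb), ?_⟩
  rw [Real.log_prod fun b hb => (hG b (hfin.mem_toFinset.1 hb)).ne',
    log_distortion_iterate hP.strictMono hz]
  set D : ℕ → ℝ := fun j => Real.log (distortion (fun i => F^[j] (z i)) F) with hD
  -- Two breaks in the same arc would be at distance less than `e < η`.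
  have hinj : ∀ b ∈ hfin.toFinset, ∀ b' ∈ hfin.toFinset, l b = l b' → b = b' := by
    have key : ∀ b ∈ B, ∀ b' ∈ B, l b = l b' → ¬ F^[l b] (t b) < F^[l b'] (t b') := by
      intro b hb b' hb' hl hlt'
      have h1 := hS.gap _ _ hlt'
        (fun h => h ((hlt b hb).2.2.2.symm ▸ hb.1)) (fun h => h ((hlt b' hb').2.2.2.symm ▸ hb'.1))
      have h2 := (hm (l b)).monotone (hlt b hb).2.2.1.1
      have h3 := (hm (l b')).monotone (hlt b' hb').2.2.1.2
      have h4 := hlen (l b)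
      rw [← hl] at h1 h3
      linarith
    intro b hb b' hb' hl
    rw [hfin.mem_toFinset] at hb hb'
    have h1 := key b hb b' hb' hl
    have h2 := key b' hb' b hb hl.symm
    rw [← (hlt b hb).2.2.2, ← (hlt b' hb').2.2.2, le_antisymm (not_lt.1 h2) (not_lt.1 h1)]
  have hsubset : hfin.toFinset.image l ⊆ Finset.range r := by
    intro j hj
    obtain ⟨b, hb, rfl⟩ := Finset.mem_image.1 hj
    exact Finset.mem_range.2 (hlt b (hfin.mem_toFinset.1 hb)).1
  have hLpos : ∀ j, 0 < F^[j] (z 3) - F^[j] (z 0) := fun j => hP.iterate_sub_pos j hz.lt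
  -- By `once`, a break in the closed arc `j` forces `j = l b`; this also excludes breaks at common
  -- end points.
  have hsmooth : ∀ j ∈ Finset.range r \ hfin.toFinset.image l,
      |D j| ≤ k₁ * e ^ α * (F^[j] (z 3) - F^[j] (z 0)) := by
    intro j hj
    rw [Finset.mem_sdiff, Finset.mem_range] at hj
    have hregj : ∀ s ∈ Icc (F^[j] (z 0)) (F^[j] (z 3)), s ∈ regularSet F := by
      intro s hs' hsb
      have hmem : (s : UnitAddCircle) ∈ iterArc F z j := ⟨s, hs', rfl⟩
      have hsB : (s : UnitAddCircle) ∈ B := ⟨hsb, j, hj.1, hmem⟩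
      have h1 := ((hreg ⟨_, hsB⟩).once _ hsB).unique
        ⟨(hlt _ hsB).1, (hlt _ hsB).2.1⟩ ⟨hj.1, hmem⟩
      exact hj.2 (Finset.mem_image.2 ⟨_, hfin.mem_toFinset.2 hsB, h1⟩)
    refine (hS.abs_log_distortion_le hP (hz.iterate hP.strictMono j) hregj).trans ?_
    have hL := hLpos j
    have h5 := Real.rpow_le_rpow hL.le (hlen j).le hS.α_pos.le
    rw [Real.rpow_add hL, Real.rpow_one, mul_comm (F^[j] (z 3) - F^[j] (z 0)), mul_assoc k₁]
    exact mul_le_mul_of_nonneg_left (mul_le_mul_of_nonneg_right h5 hL.le) hk₁0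
  have hbreak : ∀ b ∈ hfin.toFinset,
      |D (l b) - Real.log (jumpFun (jump F b) (x b) (y b))| ≤ k₂ * e := by
    intro b hb
    rw [hfin.mem_toFinset] at hb
    have h1 := hS.abs_log_distortion_sub_log_jumpFun_le hP (hz.iterate hP.strictMono (l b))
      (t := F^[l b] (t b)) ⟨(hm _).monotone (ht1 b hb).1, (hm _).monotone (ht1 b hb).2⟩
      ((hlt b hb).2.2.2.symm ▸ hb.1) ((hlen _).trans heη)
    rw [(hlt b hb).2.2.2] at h1
    exact h1.trans (mul_le_mul_of_nonneg_left (hlen _).le hk₂0)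
  have hlensum := sum_sub_le_of_isSmall (W := id) monotone_id (V := 1) (fun _ => rfl)
    hP.strictMono hz hs
  rw [← Finset.sum_sdiff hsubset, Finset.sum_image hinj, add_sub_assoc, ← Finset.sum_sub_distrib]
  refine (abs_add_le _ _).trans ((add_le_add ?_ ?_).trans heε.le)
  · refine (Finset.abs_sum_le_sum_abs _ _).trans ((Finset.sum_le_sum hsmooth).trans ?_)
    rw [← Finset.mul_sum]
    refine mul_le_of_le_one_right (by positivity) (le_trans ?_ hlensum)
    exact Finset.sum_le_sum_of_subset_of_nonneg Finset.sdiff_subset fun j _ _ => (hLpos j).le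
  · refine (Finset.abs_sum_le_sum_abs _ _).trans ((Finset.sum_le_sum hbreak).trans ?_)
    rw [Finset.sum_const, nsmul_eq_mul]
    have h1 : hfin.toFinset.card ≤ hP.finite_breaks.toFinset.card :=
      Finset.card_le_card (by
        rw [Set.Finite.toFinset_subset_toFinset]
        exact fun b hb => hb.1)
    have h2 : (hfin.toFinset.card : ℝ) ≤ hP.finite_breaks.toFinset.card := by exact_mod_cast h1
    rw [mul_assoc (hP.finite_breaks.toFinset.card : ℝ)]
    exact mul_le_mul_of_nonneg_right h2 (mul_nonneg hk₂0 he.le)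

end

/-! ### Choice of the constants and uniform separation. -/

section

/-- With `u = s + (1 - s) y`, the difference is `u (1 - u) / (u + x) + (1 - s) y`, and `0 ≤ u ≤ 1 +
s`. -/
theorem jumpFun_abs_sub_le {s x y : ℝ} (hs : 0 < s) (hx : 0 < x) (hy : 0 ≤ y) (hy1 : y ≤ 1) :
    |jumpFun s x y - s| ≤ (1 + s) ^ 2 / x + (1 + s) * y := by
  have hu : 0 ≤ s + (1 - s) * y := by
    have := mul_nonneg hs.le (sub_nonneg.2 hy1)
    linarith
  have hu1 : s + (1 - s) * y ≤ 1 + s := by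
    have := mul_nonneg hs.le hy
    linarith
  set u := s + (1 - s) * y with hu_def
  have hux : 0 < u + x := by linarith
  have h1 : jumpFun s x y - s = u * (1 - u) / (u + x) + (1 - s) * y := by
    rw [jumpFun, ← hu_def, show (1 - s) * y = u - s by rw [hu_def]; ring]
    field_simp
    ring
  have h2 : |1 - u| ≤ 1 + s := by
    rw [abs_le]
    constructor <;> linarith
  have h3 : |1 - s| ≤ 1 + s := by
    rw [abs_le]
    constructor <;> linarith
  rw [h1]
  refine (abs_add_le _ _).trans (add_le_add ?_ ?_)
  · rw [abs_div, abs_mul, abs_of_nonneg hu, abs_of_pos hux, sq]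
    exact div_le_div₀ (by positivity) (mul_le_mul hu1 h2 (abs_nonneg _) (by positivity)) hx
      (by linarith)
  · rw [abs_mul, abs_of_nonneg hy]
    exact mul_le_mul_of_nonneg_right h3 hy

/-- One integer gives both constants, `Ω = n` and `ϑ = 1 / n`, so finitely many requirements combine
by `Eventually`. -/
theorem eventually_abs_jumpFun_sub_lt {s ε : ℝ} (hs : 0 < s) (hε : 0 < ε) :
    ∀ᶠ n : ℕ in atTop, ∀ x y : ℝ, (n : ℝ) ≤ x → 0 ≤ y → y < 1 / n → |jumpFun s x y - s| < ε := by
  have h1 : Tendsto (fun n : ℕ => (1 + s) ^ 2 / (n : ℝ) + (1 + s) * (1 / (n : ℝ))) atTop (𝓝 0) := by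
    have := (tendsto_const_div_atTop_nhds_zero_nat ((1 + s) ^ 2)).add
      (tendsto_one_div_atTop_nhds_zero_nat.const_mul (1 + s))
    simpa using this
  filter_upwards [h1.eventually (gt_mem_nhds hε), eventually_ge_atTop 1] with n hn hn1 x y hx hy hyn
  have hn0 : (1 : ℝ) ≤ n := by exact_mod_cast hn1
  have hy1 : y ≤ 1 := hyn.le.trans (by rw [div_le_one (by linarith)]; exact hn0)
  refine (jumpFun_abs_sub_le hs (by linarith) hy hy1).trans_lt (lt_of_le_of_lt ?_ hn)
  gcongr

theorem eventually_abs_finprod_jumpFun_sub_le {F : CircleDeg1Lift} (hP : IsPHomeo F)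
    {B : Set UnitAddCircle} (hB : B.Finite) {ε : ℝ} (hε : 0 < ε) :
    ∀ᶠ n : ℕ in atTop, ∀ x y : UnitAddCircle → ℝ,
      (∀ b ∈ B, (n : ℝ) ≤ x b ∧ 0 ≤ y b ∧ y b < 1 / n) →
      |(∏ᶠ b ∈ B, jumpFun (jump F b) (x b) (y b)) - jumpProd F B| ≤ ε := by
  have hcont : Continuous fun g : hB.toFinset → ℝ => ∏ b, g b := by fun_prop
  obtain ⟨d, hd, hclose⟩ := Metric.continuous_iff.1 hcont (fun b => jump F b) ε hε
  have h1 : ∀ᶠ n : ℕ in atTop, ∀ b ∈ B, ∀ x y : ℝ, (n : ℝ) ≤ x → 0 ≤ y → y < 1 / n →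
      |jumpFun (jump F b) x y - jump F b| < d :=
    (eventually_all_finite hB).2 fun b _ => eventually_abs_jumpFun_sub_lt (hP.jump_pos b) hd
  filter_upwards [h1] with n hn x y hxy
  have h2 := hclose (fun b => jumpFun (jump F b) (x b) (y b)) ((dist_pi_lt_iff hd).2 fun b => by
    have hb := hB.mem_toFinset.1 b.2
    exact hn b hb _ _ (hxy b hb).1 (hxy b hb).2.1 (hxy b hb).2.2)
  rw [jumpProd, finprod_mem_eq_finite_toFinset_prod _ hB, finprod_mem_eq_finite_toFinset_prod _ hB,
    ← Finset.prod_coe_sort, ← Finset.prod_coe_sort hB.toFinset (fun b => jump F b)]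
  exact h2.le

variable {F₁ F₂ : CircleDeg1Lift}

theorem jumpGap_pos (hP₁ : IsPHomeo F₁) (hP₂ : IsPHomeo F₂) {B₁ B₂ : Set UnitAddCircle}
    (h : NotCoinciding F₁ F₂ B₁ B₂) : 0 < jumpGap F₁ F₂ B₁ B₂ :=
  lt_min (lt_min (hP₁.jumpProd_pos B₁) (hP₂.jumpProd_pos B₂)) (abs_pos.2 (sub_ne_zero.2 h))

theorem eventually_jumpConstants (hP₁ : IsPHomeo F₁) (hP₂ : IsPHomeo F₂) :
    ∀ᶠ n : ℕ in atTop, JumpConstants F₁ F₂ n (1 / n) := by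
  have h1 : ∀ᶠ n : ℕ in atTop, ∀ B₁ ∈ {B | B ⊆ breakSet F₁}, ∀ B₂ ∈ {B | B ⊆ breakSet F₂},
      NotCoinciding F₁ F₂ B₁ B₂ →
    (∀ x y : UnitAddCircle → ℝ, (∀ b ∈ B₁, (n : ℝ) ≤ x b ∧ 0 ≤ y b ∧ y b < 1 / n) →
      |(∏ᶠ b ∈ B₁, jumpFun (jump F₁ b) (x b) (y b)) - jumpProd F₁ B₁| ≤
        jumpGap F₁ F₂ B₁ B₂ / 8) ∧
    (∀ x y : UnitAddCircle → ℝ, (∀ b ∈ B₂, (n : ℝ) ≤ x b ∧ 0 ≤ y b ∧ y b < 1 / n) →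
      |(∏ᶠ b ∈ B₂, jumpFun (jump F₂ b) (x b) (y b)) - jumpProd F₂ B₂| ≤
        jumpGap F₁ F₂ B₁ B₂ / 8) := by
    refine (eventually_all_finite hP₁.finite_breaks.finite_subsets).2 fun B₁ hB₁ =>
      (eventually_all_finite hP₂.finite_breaks.finite_subsets).2 fun B₂ hB₂ => ?_
    by_cases hnc : NotCoinciding F₁ F₂ B₁ B₂
    · have hpos : 0 < jumpGap F₁ F₂ B₁ B₂ / 8 := div_pos (jumpGap_pos hP₁ hP₂ hnc) (by norm_num)
      filter_upwards [eventually_abs_finprod_jumpFun_sub_le hP₁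
        (hP₁.finite_breaks.subset hB₁) hpos, eventually_abs_finprod_jumpFun_sub_le hP₂
        (hP₂.finite_breaks.subset hB₂) hpos] with n h1 h2 _
      exact ⟨h1, h2⟩
    · exact Eventually.of_forall fun n h => absurd h hnc
  filter_upwards [h1, eventually_ge_atTop 2] with n hn hn2
  have hn2' : (2 : ℝ) ≤ n := by exact_mod_cast hn2
  refine ⟨by linarith, by positivity, ?_, fun B₁ hB₁ B₂ hB₂ => hn B₁ hB₁ B₂ hB₂⟩
  rw [div_lt_one (by linarith)]
  linarith

theorem JumpConstants.of_le {Ω θ θ' : ℝ} (h : JumpConstants F₁ F₂ Ω θ) (hθ' : 0 < θ')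
    (hle : θ' ≤ θ) : JumpConstants F₁ F₂ Ω θ' := by
  obtain ⟨h1, h2, h3, h4⟩ := h
  refine ⟨h1, hθ', hle.trans_lt h3, fun B₁ hB₁ B₂ hB₂ hnc => ?_⟩
  obtain ⟨h5, h6⟩ := h4 B₁ hB₁ B₂ hB₂ hnc
  exact ⟨fun x y h => h5 x y fun b hb => ⟨(h b hb).1, (h b hb).2.1, (h b hb).2.2.trans_le hle⟩,
    fun x y h => h6 x y fun b hb => ⟨(h b hb).1, (h b hb).2.1, (h b hb).2.2.trans_le hle⟩⟩

theorem abs_sub_le_mul_abs_log {a b m : ℝ} (ha : 0 < a) (hb : 0 < b) (ham : a ≤ m) (hbm : b ≤ m) :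
    |a - b| ≤ m * |Real.log a - Real.log b| := by
  have key : ∀ a b : ℝ, 0 < a → 0 < b → a ≤ m → a - b ≤ m * |Real.log a - Real.log b| := by
    intro a b ha hb ham
    have h1 := Real.log_le_sub_one_of_pos (div_pos hb ha)
    rw [Real.log_div hb.ne' ha.ne', le_sub_iff_add_le, le_div_iff₀ ha] at h1
    calc a - b ≤ a * (Real.log a - Real.log b) := by linarith
      _ ≤ a * |Real.log a - Real.log b| := by gcongr; exact le_abs_self _
      _ ≤ m * |Real.log a - Real.log b| := by gcongr
  have h1 := key a b ha hb ham
  have h2 := key b a hb ha hbm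
  rw [abs_sub_comm (Real.log b)] at h2
  rw [abs_le]
  constructor <;> linarith

/-- Quantities close to different jump products have quotient bounded away from `1`. -/
theorem eventually_le_abs_div_sub_one {s₁ s₂ : ℝ} (h₁ : 0 < s₁) (h₂ : 0 < s₂) (hne : s₁ ≠ s₂) :
    ∀ᶠ n : ℕ in atTop, ∀ P₁ P₂ D₁ D₂ : ℝ, 0 < P₁ → 0 < P₂ → 0 < D₁ → 0 < D₂ →
      |P₁ - s₁| ≤ min (min s₁ s₂) |s₁ - s₂| / 8 → |P₂ - s₂| ≤ min (min s₁ s₂) |s₁ - s₂| / 8 →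
      |Real.log D₁ - Real.log P₁| ≤ 1 / n → |Real.log D₂ - Real.log P₂| ≤ 1 / n →
      1 / n ≤ |D₁ / D₂ - 1| := by
  have hd := abs_pos.2 (sub_ne_zero.2 hne)
  have h1 : Tendsto (fun n : ℕ => 8 * (s₁ + s₂) * (1 / (n : ℝ))) atTop (𝓝 0) := by
    simpa using tendsto_one_div_atTop_nhds_zero_nat.const_mul (8 * (s₁ + s₂))
  filter_upwards [h1.eventually (gt_mem_nhds (show 0 < 3 / 4 * |s₁ - s₂| by positivity)),
    eventually_ge_atTop 2] with n hn hn2 P₁ P₂ D₁ D₂ hP₁ hP₂ hD₁ hD₂ e₁ e₂ l₁ l₂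
  -- Otherwise the `log D_i` differ by at most `2 / n`, the `log P_i` by `4 / n`, and the `P_i` by
  -- `8 (s₁ + s₂) / n`; yet `P₁`, `P₂` are at least `3/4 |s₁ - s₂|` apart.
  by_contra! hlt
  have hn2' : (2 : ℝ) ≤ n := by exact_mod_cast hn2
  have hhalf : 1 / (n : ℝ) ≤ 1 / 2 := one_div_le_one_div_of_le (by norm_num) hn2'
  have m1 : min (min s₁ s₂) |s₁ - s₂| ≤ s₁ := (min_le_left _ _).trans (min_le_left _ _)
  have m2 : min (min s₁ s₂) |s₁ - s₂| ≤ s₂ := (min_le_left _ _).trans (min_le_right _ _)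
  have m3 : min (min s₁ s₂) |s₁ - s₂| ≤ |s₁ - s₂| := min_le_right _ _
  set Λ := min (min s₁ s₂) |s₁ - s₂|
  have hP₁s : P₁ ≤ 2 * (s₁ + s₂) := by linarith [(abs_le.1 e₁).2]
  have hP₂s : P₂ ≤ 2 * (s₁ + s₂) := by linarith [(abs_le.1 e₂).2]
  have hlow : 3 / 4 * |s₁ - s₂| ≤ |P₁ - P₂| := by
    have h3 : |s₁ - s₂| ≤ |s₁ - P₁| + |P₁ - P₂| + |P₂ - s₂| := by
      have := abs_sub_le s₁ P₁ s₂
      have := abs_sub_le P₁ P₂ s₂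
      linarith
    rw [abs_sub_comm s₁ P₁] at h3
    linarith
  have hq : |Real.log D₁ - Real.log D₂| ≤ 2 * (1 / n) := by
    have h3 : (1 : ℝ) / 2 ≤ D₁ / D₂ := by linarith [(abs_lt.1 hlt).1]
    have h4 := abs_log_sub_log_le (by norm_num : (0 : ℝ) < 1 / 2) h3 (by norm_num : (1 : ℝ) / 2 ≤ 1)
    rw [Real.log_one, sub_zero, Real.log_div hD₁.ne' hD₂.ne'] at h4
    linarith
  have hPlog : |Real.log P₁ - Real.log P₂| ≤ 4 * (1 / n) := by
    rw [abs_le] at hq l₁ l₂ ⊢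
    constructor <;> linarith [hq.1, hq.2, l₁.1, l₁.2, l₂.1, l₂.2]
  have h5 := abs_sub_le_mul_abs_log hP₁ hP₂ hP₁s hP₂s
  have h6 := mul_le_mul_of_nonneg_left hPlog (show 0 ≤ 2 * (s₁ + s₂) by positivity)
  linarith

/-- `R` is both the admissible logarithmic error and the resulting lower bound; it is uniform
because there are finitely many pairs of sets. -/
theorem exists_uniform_gap (hP₁ : IsPHomeo F₁) (hP₂ : IsPHomeo F₂) :
    ∃ R > 0, ∀ B₁ ⊆ breakSet F₁, ∀ B₂ ⊆ breakSet F₂, NotCoinciding F₁ F₂ B₁ B₂ →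
      ∀ P₁ P₂ D₁ D₂ : ℝ, 0 < P₁ → 0 < P₂ → 0 < D₁ → 0 < D₂ →
      |P₁ - jumpProd F₁ B₁| ≤ jumpGap F₁ F₂ B₁ B₂ / 8 →
      |P₂ - jumpProd F₂ B₂| ≤ jumpGap F₁ F₂ B₁ B₂ / 8 →
      |Real.log D₁ - Real.log P₁| ≤ R → |Real.log D₂ - Real.log P₂| ≤ R →
      R ≤ |D₁ / D₂ - 1| := by
  have h1 : ∀ᶠ n : ℕ in atTop, ∀ B₁ ∈ {B | B ⊆ breakSet F₁}, ∀ B₂ ∈ {B | B ⊆ breakSet F₂},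
      NotCoinciding F₁ F₂ B₁ B₂ →
      ∀ P₁ P₂ D₁ D₂ : ℝ, 0 < P₁ → 0 < P₂ → 0 < D₁ → 0 < D₂ →
      |P₁ - jumpProd F₁ B₁| ≤ jumpGap F₁ F₂ B₁ B₂ / 8 →
      |P₂ - jumpProd F₂ B₂| ≤ jumpGap F₁ F₂ B₁ B₂ / 8 →
      |Real.log D₁ - Real.log P₁| ≤ 1 / n → |Real.log D₂ - Real.log P₂| ≤ 1 / n →
      1 / n ≤ |D₁ / D₂ - 1| := by
    refine (eventually_all_finite hP₁.finite_breaks.finite_subsets).2 fun B₁ _ =>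
      (eventually_all_finite hP₂.finite_breaks.finite_subsets).2 fun B₂ _ => ?_
    by_cases hnc : NotCoinciding F₁ F₂ B₁ B₂
    · filter_upwards [eventually_le_abs_div_sub_one (hP₁.jumpProd_pos B₁) (hP₂.jumpProd_pos B₂)
        hnc] with n hn _
      exact hn
    · exact Eventually.of_forall fun n h => absurd h hnc
  obtain ⟨n, hn, hn1⟩ := (h1.and (eventually_ge_atTop 1)).exists
  have hn0 : (1 : ℝ) ≤ n := by exact_mod_cast hn1
  exact ⟨1 / n, by positivity, fun B₁ hB₁ B₂ hB₂ => hn B₁ hB₁ B₂ hB₂⟩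

/-- Convergents approach the rotation number, while rationals of bounded denominator stay away from
an irrational. -/
theorem eventually_le_qden {F : CircleDeg1Lift} (hirr : Irrational F.translationNumber) (R : ℕ) :
    ∀ᶠ n in atTop, R ≤ qden F n := by
  set ξ := F.translationNumber
  have hconv : Tendsto (fun n => ((ξ.convergent n : ℚ) : ℝ)) atTop (𝓝 ξ) :=
    (GenContFract.of_convergence ξ).congr fun n => Real.convs_eq_convergent ξ n
  obtain ⟨e, he, hle⟩ : ∃ e > 0, ∀ q : ℚ, q.den ≤ R → e ≤ dist ξ q :=
    (eventually_mem_nhdsWithin.and (nhdsWithin_le_nhds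
      (hirr.eventually_forall_le_dist_cast_rat_of_den_le R) :
      ∀ᶠ e in 𝓝[>] (0 : ℝ), ∀ q : ℚ, q.den ≤ R → e ≤ dist ξ q)).exists
  filter_upwards [Metric.tendsto_nhds.1 hconv e he] with n hn
  by_contra! hlt
  have := hle _ hlt.le
  rw [dist_comm] at hn
  linarith

end

end BreakCircle

/-! ### The lemma. -/

open BreakCircle in
theorem lemma5p3
    (f₁ f₂ : UnitAddCircle ≃ₜ UnitAddCircle) (F₁ F₂ : CircleDeg1Lift)
    (hF₁ : BreakCircle.IsLift F₁ f₁) (hF₂ : BreakCircle.IsLift F₂ f₂)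
    (hP₁ : BreakCircle.IsPHomeo F₁) (hP₂ : BreakCircle.IsPHomeo F₂)
    (hirr : Irrational F₁.translationNumber)
    (hrot : (F₁.translationNumber : UnitAddCircle) = (F₂.translationNumber : UnitAddCircle))
    (hC₁ : BreakCircle.IsPiecewiseC2Holder F₁) (hC₂ : BreakCircle.IsPiecewiseC2Holder F₂)
    (hjump : BreakCircle.jumpProd F₁ (BreakCircle.breakSet F₁) ≠
      BreakCircle.jumpProd F₂ (BreakCircle.breakSet F₂)) :
    ∃ Ω ϑ R₅ : ℝ, BreakCircle.JumpConstants F₁ F₂ Ω ϑ ∧ 0 < R₅ ∧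
      ∀ (h : UnitAddCircle ≃ₜ UnitAddCircle) (H : CircleDeg1Lift), BreakCircle.IsLift H h →
      (∀ x, h (f₁ x) = f₂ (h x)) →
      ∀ x₀ K δ : ℝ, BreakCircle.constM F₁ F₂ Ω < K → 0 < δ →
      ∃ N : ℕ, ∀ n ≥ N, ∀ r : ℕ,
        (r = BreakCircle.qden F₁ (n - 1) ∨ r = BreakCircle.qden F₁ n ∨
          r = BreakCircle.qden F₁ n + BreakCircle.qden F₁ (n - 1)) →
        ∀ (z : Fin 4 → ℝ) (B₁ B₂ : Set UnitAddCircle),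
          B₁ ⊆ BreakCircle.breakSet F₁ → B₂ ⊆ BreakCircle.breakSet F₂ →
          BreakCircle.NotCoinciding F₁ F₂ B₁ B₂ →
          BreakCircle.RegularPairCover F₁ F₂ H B₁ B₂ K (BreakCircle.constM F₁ F₂ Ω) δ
            (BreakCircle.constζ F₁ F₂ ϑ) x₀ r z →
          R₅ ≤ |BreakCircle.distortion z (F₁^[r]) /
              BreakCircle.distortion (fun i => H (z i)) (F₂^[r]) - 1| := by

  have hirr₂ : Irrational F₂.translationNumber := by
    obtain ⟨m, hm⟩ := (coe_eq_coe_iff _ _).1 hrot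
    rw [hm] at hirr
    simpa using hirr.sub_intCast m
  obtain ⟨k, hJ⟩ := (eventually_jumpConstants hP₁ hP₂).exists
  obtain ⟨R, hR, hgap⟩ := exists_uniform_gap hP₁ hP₂
  set θ : ℝ := 1 / (k : ℝ)
  set Ω : ℝ := (k : ℝ)
  have hΩ : 0 < Ω := one_pos.trans hJ.1
  have hθ := hJ.2.1
  set v₁ := (logVar F₁).toReal with hv₁
  set v₂ := (logVar F₂).toReal with hv₂
  have hexp : Real.exp (-(max v₁ v₂ - min v₁ v₂)) ≤ 1 :=
    Real.exp_le_one_iff.2 (by linarith [min_le_max (a := v₁) (b := v₂)])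
  -- `ζ₀` is defined with the smaller variation, hence the additional factor in `ϑ`
  set ϑ : ℝ := θ * Real.exp (-(max v₁ v₂ - min v₁ v₂)) with hϑ
  have hM : ∀ v, v ≤ max v₁ v₂ → Ω * Real.exp v ≤ constM F₁ F₂ Ω := fun v hv =>
    mul_le_mul_of_nonneg_left (Real.exp_le_exp.2 hv) hΩ.le
  have hζ : ∀ v, v ≤ max v₁ v₂ → constζ F₁ F₂ ϑ * Real.exp v ≤ θ := by
    intro v hv
    rw [constζ, hϑ, mul_assoc, mul_assoc, ← Real.exp_add, ← Real.exp_add]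
    exact mul_le_of_le_one_right hθ.le (Real.exp_le_one_iff.2 (by linarith))
  refine ⟨Ω, ϑ, R, hJ.of_le (mul_pos hθ (Real.exp_pos _)) (mul_le_of_le_one_right hθ.le hexp), hR,
    fun h H hH hconj x₀ K δ _ _ => ?_⟩
  obtain ⟨N₁, hN₁⟩ := hP₁.exists_log_distortion_close hirr hC₁ hΩ hθ hJ.2.2.1.le hR
  obtain ⟨N₂, hN₂⟩ := hP₂.exists_log_distortion_close hirr₂ hC₂ hΩ hθ hJ.2.2.1.le hR
  obtain ⟨N, hN⟩ := Filter.eventually_atTop.1 (eventually_le_qden hirr (max N₁ N₂))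
  -- The shift by one makes `n - 1 ≥ N`, so that `q_{n-1}` is large too.
  refine ⟨N + 1, fun n hn r hr z B₁ B₂ hB₁ hB₂ hnc hcov => ?_⟩
  have hr' : max N₁ N₂ ≤ r := by
    have h1 := hN n (by omega)
    have h2 := hN (n - 1) (by omega)
    rcases hr with rfl | rfl | rfl <;> omega
  -- Regularity is available only for a nonempty `B_i`; the other map inherits both properties
  -- through `h`. Two empty sets would coincide, both products being `1`.
  have hz : CyclicLift z ∧ IsSmall F₁ r z := by
    rcases B₁.eq_empty_or_nonempty with rfl | hne
    · rcases B₂.eq_empty_or_nonempty with rfl | hne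
      · exact absurd (by simp [jumpProd]) hnc
      · have h2 := hcov.regular₂ hne
        exact ⟨(cyclicLift_conj_iff hH.strictMono z).1 h2.cyclic,
          (isSmall_conj_iff hF₁ hF₂ hH hconj r z).1 h2.small⟩
    · exact ⟨(hcov.regular₁ hne).cyclic, (hcov.regular₁ hne).small⟩
  have hz₂ := (cyclicLift_conj_iff hH.strictMono z).2 hz.1
  have hs₂ := (isSmall_conj_iff hF₁ hF₂ hH hconj r z).2 hz.2
  obtain ⟨c₁, c₂, g₁, g₂⟩ := hcov
  subst c₁ c₂
  obtain ⟨x₁, y₁, hxy₁, hp₁, hl₁⟩ := hN₁ r ((le_max_left _ _).trans hr') z hz.1 hz.2 _ _ _ _ _ g₁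
    (hM _ (le_max_left _ _)) (hζ _ (le_max_left _ _))
  obtain ⟨x₂, y₂, hxy₂, hp₂, hl₂⟩ := hN₂ r ((le_max_right _ _).trans hr') _ hz₂ hs₂ _ _ _ _ _ g₂
    (hM _ (le_max_right _ _)) (hζ _ (le_max_right _ _))
  obtain ⟨j₁, j₂⟩ := hJ.2.2.2 _ hB₁ _ hB₂ hnc
  exact hgap _ hB₁ _ hB₂ hnc _ _ _ _ hp₁ hp₂
    (distortion_iterate_pos hP₁.strictMono hz.1 r) (distortion_iterate_pos hP₂.strictMono hz₂ r)
    (j₁ x₁ y₁ hxy₁) (j₂ x₂ y₂ hxy₂) hl₁ hl₂
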